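/- Consider the $T$-period binomial market ($T\ge 0$) with bond price $1$ and stock prices $P_0=S>0$, $P_k=S a_1\cdots a_k$, where the $a_i$ are independent, equal to $u$ with probability $p$ and to $d$ with probability $1-p$, $0<d<1<u$, $0<p<1$. Buying and selling stock carry proportional costs $\lambda_0>0$ and $0<\lambda_1<1$; put $h(z)=(1+\lambda_0)z$ for $z>0$ and $h(z)=(1-\lambda_1)z$ for $z\le 0$. A strategy is a process $I(0),\dots,I(T)$ with $I(k)$ a real-valued function of $(a_1,\dots,a_k)$ (the number of shares bought at time $k$); from initial positions $(x_0,x_1)$ in cash and shares it leads to $$X^0(k)=x_0-\sum_{l=0}^k h(I(l))P_l,\qquad X^1(k)=x_1+\sum_{l=0}^k I(l),$$ and it is admissible if $L_k:=X^0(k)-h(-X^1(k))P_k\ge 0$ for $k=0,\dots,T$. Let $U(x)=x^\gamma/\gamma$ with $0<\gamma<1$, and let $V(x_0,x_1)$ be the maximum of $E[U(L_T)]$ over all admissible strategies. Put $\mu=\gamma/(\gamma-1)$ and define functions on $[1-\lambda_1,1+\lambda_0]$ by $\hat V_T=1$ and, for $k=T-1,\dots,0$, $$\hat V_k(A)=\inf\{p^{1-\mu}\alpha^\mu\hat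 V_{k+1}(A^u)+(1-p)^{1-\mu}(1-\alpha)^\mu\hat V_{k+1}(A^d)\},$$ the infimum being over $0<\alpha<1$ and $A^u,A^d\in[1-\lambda_1,1+\lambda_0]$ with $\alpha uA^u+(1-\alpha)dA^d=A$. Theorem. Assume $x_0-h(-x_1)S>0$. Then the maximum $V(x_0,x_1)$ exists and $$V(x_0,x_1)=\frac1\gamma\inf_{1-\lambda_1\le R\le 1+\lambda_0}(x_0+x_1SR)^\gamma(\hat V_0(R))^{1-\gamma}.$$ In particular, if $pu+(1-p)d>1$ and $x_1\le 0$, the infimum is attained at $R=1+\lambda_0$, so that $$V(x_0,x_1)=\frac1\gamma(x_0+x_1S(1+\lambda_0))^\gamma(\hat V_0(1+\lambda_0))^{1-\gamma};$$ if $pu+(1-p)d<1$ and $x_1\ge 0$, it is attained at $R=1-\lambda_1$, so that $$V(x_0,x_1)=\frac1\gamma(x_0+x_1S(1-\lambda_1))^\gamma(\hat V_0(1-\lambda_1))^{1-\gamma}.$$ -/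

import Mathlib

namespace BinomialMarket

/-- The sample space of the `T`-period binomial model: `true` codes an up move (factor `u`),
`false` a down move (factor `d`). -/
abbrev Path (T : ℕ) : Type := Fin T → Bool

/-- The return factor of a single move. -/
noncomputable def factor (u d : ℝ) (b : Bool) : ℝ := if b then u else d

/-- The stock price `S * a_1 * ... * a_k` at time `k`; the bond price is `1` at all times. -/
noncomputable def price {T : ℕ} (u d S : ℝ) (k : ℕ) (ω : Path T) : ℝ :=
  S * ∏ i ∈ Finset.univ.filter (fun i : Fin T => (i : ℕ) < k), factor u d (ω i)

/-- The probability `p ^ m * (1 - p) ^ (T - m)` of a path with `m` up moves. -/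
noncomputable def prob {T : ℕ} (p : ℝ) (ω : Path T) : ℝ :=
  p ^ (Finset.card {i : Fin T | ω i = true}) *
    (1 - p) ^ (T - Finset.card {i : Fin T | ω i = true})

/-- Expectation on the (finite) sample space. -/
noncomputable def expect {T : ℕ} (p : ℝ) (f : Path T → ℝ) : ℝ :=
  ∑ ω : Path T, prob p ω * f ω

/-- Cash needed for a trade of `z` units' worth of stock, with proportional costs `lam0` for buying
and `lam1` for selling. -/
noncomputable def h (lam0 lam1 z : ℝ) : ℝ :=
  if 0 < z then (1 + lam0) * z else (1 - lam1) * z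

/-- A process is adapted if its value at time `k ≤ T` depends only on the first `k` moves. -/
def IsAdapted {T : ℕ} (I : ℕ → Path T → ℝ) : Prop :=
  ∀ k ≤ T, ∀ ω ω' : Path T, (∀ i : Fin T, (i : ℕ) < k → ω i = ω' i) → I k ω = I k ω'

/-- Cash position at time `k` (after the trade at time `k`). -/
noncomputable def cash {T : ℕ} (u d S lam0 lam1 x0 : ℝ) (I : ℕ → Path T → ℝ) (k : ℕ)
    (ω : Path T) : ℝ :=
  x0 - ∑ l ∈ Finset.range (k + 1), h lam0 lam1 (I l ω) * price u d S l ω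

/-- Number of shares held at time `k` (after the trade at time `k`). -/
noncomputable def shares {T : ℕ} (x1 : ℝ) (I : ℕ → Path T → ℝ) (k : ℕ) (ω : Path T) : ℝ :=
  x1 + ∑ l ∈ Finset.range (k + 1), I l ω

/-- Liquidation value of the portfolio at time `k`. -/
noncomputable def liquidation {T : ℕ} (u d S lam0 lam1 x0 x1 : ℝ) (I : ℕ → Path T → ℝ) (k : ℕ)
    (ω : Path T) : ℝ :=
  cash u d S lam0 lam1 x0 I k ω - h lam0 lam1 (-shares x1 I k ω) * price u d S k ω

/-- Admissible trading strategies: `I k` is the number of shares bought (sold, if negative) at time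
`k = 0, ..., T`; it is adapted and keeps the liquidation value nonnegative. -/
def IsAdmissible {T : ℕ} (u d S lam0 lam1 x0 x1 : ℝ) (I : ℕ → Path T → ℝ) : Prop :=
  IsAdapted I ∧ ∀ k ≤ T, ∀ ω : Path T, 0 ≤ liquidation u d S lam0 lam1 x0 x1 I k ω

/-- Power utility. -/
noncomputable def powerUtility (γ x : ℝ) : ℝ := x ^ γ / γ

/-- The expected utilities of terminal liquidation value that admissible strategies generate. -/
def expectedUtilities (T : ℕ) (u d p S lam0 lam1 : ℝ) (U : ℝ → ℝ) (x0 x1 : ℝ) : Set ℝ :=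
  {v | ∃ I : ℕ → Path T → ℝ, IsAdmissible u d S lam0 lam1 x0 x1 I ∧
    v = expect p fun ω => U (liquidation u d S lam0 lam1 x0 x1 I T ω)}

/-- The value function `V(x0, x1)` of the expected utility problem. -/
noncomputable def value (T : ℕ) (u d p S lam0 lam1 : ℝ) (U : ℝ → ℝ) (x0 x1 : ℝ) : ℝ :=
  sSup (expectedUtilities T u d p S lam0 lam1 U x0 x1)

/-- One backward step of the scaled recursion, with exponent `μ < 0`. The weights `α = 0` and
`α = 1` are left out: there `0 ^ μ` means `+∞` (not Lean's value `0`), so that they never matter for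
the infimum. -/
noncomputable def scaledStep (u d p lam0 lam1 μ : ℝ) (g : ℝ → ℝ) (A : ℝ) : ℝ :=
  sInf {v | ∃ α Au Ad : ℝ, 0 < α ∧ α < 1 ∧
    Au ∈ Set.Icc (1 - lam1) (1 + lam0) ∧ Ad ∈ Set.Icc (1 - lam1) (1 + lam0) ∧
    α * u * Au + (1 - α) * d * Ad = A ∧
    v = p ^ (1 - μ) * α ^ μ * g Au + (1 - p) ^ (1 - μ) * (1 - α) ^ μ * g Ad}

/-- The scaled recursion, indexed by the number of periods left. -/
noncomputable def scaledToGo (u d p lam0 lam1 μ : ℝ) : ℕ → ℝ → ℝ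
  | 0 => fun _ => 1
  | n + 1 => scaledStep u d p lam0 lam1 μ (scaledToGo u d p lam0 lam1 μ n)

/-- The scaled dual value function at time `k ≤ T` for power utility with exponent `γ`: the
recursion with terminal value `1` at time `T` and `μ = γ / (γ - 1)`. -/
noncomputable def Vhat (T : ℕ) (u d p lam0 lam1 γ : ℝ) (k : ℕ) (A : ℝ) : ℝ :=
  scaledToGo u d p lam0 lam1 (γ / (γ - 1)) (T - k) A

/-- The function of `R` that the duality formula minimizes over `[1 - lam1, 1 + lam0]`. -/
noncomputable def dualObjective (T : ℕ) (u d p S lam0 lam1 γ x0 x1 R : ℝ) : ℝ :=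
  (x0 + x1 * S * R) ^ γ * Vhat T u d p lam0 lam1 γ 0 R ^ (1 - γ)

end BinomialMarket

namespace BinomialMarket

open Set

/-! The proof is convex duality by induction on the number of periods. A dual variable is a
multiplier `y > 0` for cash together with a shadow price `R * S`, where `R` lies in the bid-ask
interval. At such a price trading without costs is at least as good as trading at the actual terms.

Weak duality (`expect_powerUtility_le`): every `(y, R)` bounds the expected utility by `y (x0 + x1 S
R) + (1/γ - 1) y^μ V̂(R)`. In the induction the multiplier becomes `yα/p` after an up move and
`y(1-α)/(1-p)` after a down move, and the constraint on `α, Au, Ad` says that the weighted shadow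
price is a martingale. Minimizing over `y` by Young's inequality gives the objective of the theorem.

Strong duality (`dual_le_of_value_le`): the value function is concave, so some affine function
majorizes it and touches it at `(x0, x1)`. Its slopes are a dual variable (`dual_mem_of_value_le`),
and its constant term is at least the conjugate term `(1/γ - 1) y^μ V̂(R)`. For the latter, waiting
one period shows that the affine function also majorizes the average of the two continuation values.
The sandwich theorem splits it into a majorant for each branch, and the slopes of these supply `α`,
`Au`, `Ad`. Only this one inequality of dynamic programming is needed, and the infima in the
recursion need not be attained.

Optimal strategies exist by compactness, since solvency bounds all trades. In the special cases the
drift makes `V̂` monotone, so both factors of the objective are smallest at the same endpoint. -/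

/-! ### Separation of concave functions -/

/-- A sandwich theorem: if `f + g ≤ 0` on `A ∩ B` for concave `f` and `g`, an affine function
separates `f` from `-g`. -/
theorem exists_affine_between {A B : Set (ℝ × ℝ)} {f g : ℝ × ℝ → ℝ} (hA : IsOpen A)
    (hf : ConcaveOn ℝ A f) (hg : ConcaveOn ℝ B g) (hne : (A ∩ B).Nonempty)
    (hfg : ∀ x ∈ A ∩ B, f x + g x ≤ 0) :
    ∃ m0 m1 C : ℝ, (∀ x ∈ A, f x ≤ m0 * x.1 + m1 * x.2 + C) ∧
      ∀ x ∈ B, g x ≤ -(m0 * x.1 + m1 * x.2 + C) := by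
  have hfc : ContinuousOn f A := hf.continuousOn hA
  have hopen : IsOpen {q : (ℝ × ℝ) × ℝ | q.1 ∈ A ∧ q.2 < f q.1} := by
    have hA' : IsOpen (A ×ˢ (univ : Set ℝ)) := hA.prod isOpen_univ
    have hc : ContinuousOn (fun q : (ℝ × ℝ) × ℝ => f q.1 - q.2) (A ×ˢ (univ : Set ℝ)) :=
      (hfc.comp continuousOn_fst (fun q hq => hq.1)).sub continuousOn_snd
    have := hc.isOpen_inter_preimage hA' (isOpen_Ioi (a := (0 : ℝ)))
    convert this using 1
    ext q
    simp [sub_pos]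
  have hcvB : Convex ℝ {q : (ℝ × ℝ) × ℝ | q.1 ∈ B ∧ -g q.1 ≤ q.2} := hg.neg.convex_epigraph
  obtain ⟨φ, c, h1, h2⟩ := geometric_hahn_banach_open hf.convex_strict_hypograph hopen hcvB (by
    rw [Set.disjoint_left]
    rintro q ⟨hqA, hq⟩ ⟨hqB, hq'⟩
    have := hfg q.1 ⟨hqA, hqB⟩
    linarith)
  have hφ : ∀ q : (ℝ × ℝ) × ℝ,
      φ q = φ ((1, 0), 0) * q.1.1 + φ ((0, 1), 0) * q.1.2 + φ ((0, 0), 1) * q.2 := by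
    intro q
    have : q = q.1.1 • ((1, 0), 0) + q.1.2 • ((0, 1), 0) + q.2 • (((0, 0), 1) : (ℝ × ℝ) × ℝ) := by
      ext <;> simp
    conv_lhs => rw [this]
    simp only [map_add, map_smul, smul_eq_mul]
    ring
  set a := φ ((1, 0), 0)
  set b := φ ((0, 1), 0)
  set t := φ ((0, 0), 1)
  obtain ⟨x, hxA, hxB⟩ := hne
  -- Over a common point of `A` and `B` the hyperplane separates two points of the same vertical
  -- line, so it is not vertical.
  have ht : 0 < t := by
    have e1 := h1 (x, f x - 1) ⟨hxA, by simp⟩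
    have e2 := h2 (x, -g x) ⟨hxB, le_rfl⟩
    rw [hφ] at e1 e2
    have := hfg x ⟨hxA, hxB⟩
    simp only at e1 e2
    nlinarith
  refine ⟨-a / t, -b / t, c / t, fun y hy => ?_, fun y hy => ?_⟩
  · have : a * y.1 + b * y.2 + t * f y ≤ c := by
      refine le_of_forall_pos_le_add fun ε hε => ?_
      have e1 := h1 (y, f y - ε / t) ⟨hy, by have := div_pos hε ht; simp; exact this⟩
      rw [hφ] at e1
      have : t * (f y - ε / t) = t * f y - ε := by field_simp
      simp only at e1
      linarith
    have e : -a / t * y.1 + -b / t * y.2 + c / t = (c - a * y.1 - b * y.2) / t := by ring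
    rw [e, le_div_iff₀ ht]
    linarith
  · have e2 := h2 (y, -g y) ⟨hy, le_rfl⟩
    rw [hφ] at e2
    simp only at e2
    have e : -(-a / t * y.1 + -b / t * y.2 + c / t) = (a * y.1 + b * y.2 - c) / t := by ring
    rw [e, le_div_iff₀ ht]
    linarith

/-! ### Power utility, its conjugate and the one-step weight -/

theorem exponent_neg {γ : ℝ} (hγ : 0 < γ) (hγ1 : γ < 1) : γ / (γ - 1) < 0 :=
  div_neg_of_pos_of_neg hγ (by linarith)

theorem exponent_mul {γ : ℝ} (hγ1 : γ < 1) : γ / (γ - 1) * (1 - γ) = -γ := by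
  have : γ - 1 ≠ 0 := by linarith
  field_simp
  ring

/-- Young's inequality for the power utility and its conjugate function, with a weight `v`. -/
theorem powerUtility_le_conjugate {γ : ℝ} (hγ : 0 < γ) (hγ1 : γ < 1) {x y v : ℝ} (hx : 0 ≤ x)
    (hy : 0 < y) (hv : 0 ≤ v) :
    1 / γ * (x ^ γ * v ^ (1 - γ)) ≤ y * x + (1 / γ - 1) * (y ^ (γ / (γ - 1)) * v) := by
  have h := Real.geom_mean_le_arith_mean2_weighted hγ.le (by linarith : 0 ≤ 1 - γ)
    (mul_nonneg hy.le hx) (mul_nonneg (Real.rpow_nonneg hy.le (γ / (γ - 1))) hv) (by ring)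
  have e : (y * x) ^ γ * (y ^ (γ / (γ - 1)) * v) ^ (1 - γ) = x ^ γ * v ^ (1 - γ) := by
    rw [Real.mul_rpow hy.le hx, Real.mul_rpow (Real.rpow_nonneg hy.le _) hv, ← Real.rpow_mul hy.le,
      exponent_mul hγ1, Real.rpow_neg hy.le]
    have := (Real.rpow_pos_of_pos hy γ).ne'
    field_simp
  rw [e] at h
  calc _ ≤ 1 / γ * (γ * (y * x) + (1 - γ) * (y ^ (γ / (γ - 1)) * v)) := by gcongr
    _ = _ := by field_simp

/-- Young's inequality is an equality for a suitable multiplier. -/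
theorem exists_conjugate_eq {γ : ℝ} (hγ1 : γ < 1) {x v : ℝ} (hx : 0 < x)
    (hv : 0 < v) :
    ∃ y, 0 < y ∧
      y * x + (1 / γ - 1) * (y ^ (γ / (γ - 1)) * v) = 1 / γ * (x ^ γ * v ^ (1 - γ)) := by
  refine ⟨(x / v) ^ (γ - 1), Real.rpow_pos_of_pos (div_pos hx hv) _, ?_⟩
  have hxv := div_pos hx hv
  have h1 : γ - 1 ≠ 0 := by linarith
  rw [← Real.rpow_mul hxv.le, mul_div_cancel₀ _ h1]
  have e1 : (x / v) ^ (γ - 1) * x = x ^ γ * v ^ (1 - γ) := by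
    rw [Real.div_rpow hx.le hv.le, Real.rpow_sub_one hx.ne', ← neg_sub γ 1, Real.rpow_neg hv.le]
    field_simp
  have e2 : (x / v) ^ γ * v = x ^ γ * v ^ (1 - γ) := by
    rw [Real.div_rpow hx.le hv.le, Real.rpow_sub hv, Real.rpow_one]
    field_simp
  rw [e1, e2]
  ring

/-- Negative powers are convex on the positive half line. -/
theorem convexOn_rpow_of_nonpos {μ : ℝ} (hμ : μ ≤ 0) :
    ConvexOn ℝ (Ioi 0) fun x : ℝ => x ^ μ := by
  refine ⟨convex_Ioi 0, fun x hx y hy a b ha hb hab => ?_⟩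
  have hx : 0 < x := hx
  have hy : 0 < y := hy
  have h1 := Real.geom_mean_le_arith_mean2_weighted ha hb hx.le hy.le hab
  have h2 := Real.geom_mean_le_arith_mean2_weighted ha hb (Real.rpow_nonneg hx.le μ)
    (Real.rpow_nonneg hy.le μ) hab
  have hpos : 0 < x ^ a * y ^ b := by positivity
  -- Weighted AM-GM is used twice: for `x, y`, where the negative exponent reverses it, and for `x ^
  -- μ, y ^ μ`.
  calc (a • x + b • y) ^ μ ≤ (x ^ a * y ^ b) ^ μ := Real.rpow_le_rpow_of_nonpos hpos h1 hμ
    _ = (x ^ μ) ^ a * (y ^ μ) ^ b := by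
      rw [Real.mul_rpow (by positivity) (by positivity), ← Real.rpow_mul hx.le,
        ← Real.rpow_mul hy.le, ← Real.rpow_mul hx.le, ← Real.rpow_mul hy.le, mul_comm a, mul_comm b]
    _ ≤ _ := h2

/-- The value of one step of the scaled recursion at `α`, when nothing remains to be done. -/
noncomputable def stepWeight (p μ α : ℝ) : ℝ :=
  p ^ (1 - μ) * α ^ μ + (1 - p) ^ (1 - μ) * (1 - α) ^ μ

theorem convexOn_stepWeight {p μ : ℝ} (hp : 0 < p) (hp1 : p < 1) (hμ : μ ≤ 0) :
    ConvexOn ℝ (Ioo 0 1) (stepWeight p μ) := by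
  have h1 : ConvexOn ℝ (Ioo 0 1) fun α : ℝ => α ^ μ :=
    (convexOn_rpow_of_nonpos hμ).subset (fun x hx => hx.1) (convex_Ioo 0 1)
  have h2 : ConvexOn ℝ (Ioo 0 1) fun α : ℝ => (1 - α) ^ μ := by
    refine ⟨convex_Ioo 0 1, fun x hx y hy a b ha hb hab => ?_⟩
    have := (convexOn_rpow_of_nonpos hμ).2 (sub_pos.2 hx.2 : 0 < 1 - x)
      (sub_pos.2 hy.2 : 0 < 1 - y) ha hb hab
    simp only [smul_eq_mul] at this ⊢
    convert this using 2
    linear_combination -hab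
  have hq : 0 < 1 - p := by linarith
  exact (h1.smul (Real.rpow_nonneg hp.le (1 - μ))).add (h2.smul (Real.rpow_nonneg hq.le (1 - μ)))

theorem stepWeight_self {p μ : ℝ} (hp : 0 < p) (hp1 : p < 1) : stepWeight p μ p = 1 := by
  have hq : 0 < 1 - p := by linarith
  rw [stepWeight, ← Real.rpow_add hp, ← Real.rpow_add hq]
  simp

/-- Jensen's inequality for `x ^ μ` at the likelihood ratios `α / p` and `(1 - α) / (1 - p)`, whose
mean under `p` is `1`. -/
theorem one_le_stepWeight {p μ α : ℝ} (hp : 0 < p) (hp1 : p < 1) (hμ : μ ≤ 0) (hα : 0 < α)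
    (hα1 : α < 1) : 1 ≤ stepWeight p μ α := by
  have hq : 0 < 1 - p := by linarith
  have hα' : 0 < 1 - α := by linarith
  have h := (convexOn_rpow_of_nonpos hμ).2 (div_pos hα hp : 0 < α / p)
    (div_pos hα' hq : 0 < (1 - α) / (1 - p)) hp.le hq.le (by ring)
  have e : p • (α / p) + (1 - p) • ((1 - α) / (1 - p)) = 1 := by
    simp only [smul_eq_mul]; field_simp; ring
  beta_reduce at h
  rw [e, Real.one_rpow, smul_eq_mul, smul_eq_mul] at h
  rw [Real.div_rpow hα.le hp.le, Real.div_rpow hα'.le hq.le] at h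
  refine h.trans (le_of_eq ?_)
  rw [stepWeight, Real.rpow_sub hp, Real.rpow_sub hq, Real.rpow_one, Real.rpow_one]
  ring

/-- The weight decreases as `α` moves towards `p`. -/
theorem stepWeight_le_of_mem_segment {p μ α β : ℝ} (hp : 0 < p) (hp1 : p < 1) (hμ : μ ≤ 0)
    (hα : 0 < α) (hα1 : α < 1) (hβ : β ∈ segment ℝ α p) : stepWeight p μ β ≤ stepWeight p μ α := by
  have h := (convexOn_stepWeight hp hp1 hμ).le_on_segment ⟨hα, hα1⟩ ⟨hp, hp1⟩ hβ
  rwa [stepWeight_self hp hp1, max_eq_left (one_le_stepWeight hp hp1 hμ hα hα1)] at h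

/-! ### The scaled dual recursion and its monotonicity -/

section ScaledRecursion

variable {u d p lam0 lam1 μ : ℝ} {g : ℝ → ℝ}

/-- The set whose infimum is `scaledStep`. -/
def stepValues (u d p lam0 lam1 μ : ℝ) (g : ℝ → ℝ) (A : ℝ) : Set ℝ :=
  {v | ∃ α Au Ad : ℝ, 0 < α ∧ α < 1 ∧
    Au ∈ Set.Icc (1 - lam1) (1 + lam0) ∧ Ad ∈ Set.Icc (1 - lam1) (1 + lam0) ∧
    α * u * Au + (1 - α) * d * Ad = A ∧
    v = p ^ (1 - μ) * α ^ μ * g Au + (1 - p) ^ (1 - μ) * (1 - α) ^ μ * g Ad}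

/-- The risk-neutral probability `(1 - d) / (u - d)` with a constant ratio `A` is feasible. This
excludes the default value of `sInf` on the empty set. -/
theorem stepValues_nonempty (hd1 : d < 1) (hu : 1 < u) {A : ℝ}
    (hA : A ∈ Icc (1 - lam1) (1 + lam0)) : (stepValues u d p lam0 lam1 μ g A).Nonempty := by
  have hud : 0 < u - d := by linarith
  refine ⟨_, (1 - d) / (u - d), A, A, div_pos (by linarith) hud, ?_, hA, hA, ?_, rfl⟩
  · rw [div_lt_one hud]; linarith
  · field_simp; ring

theorem one_le_of_mem_stepValues (hp : 0 < p) (hp1 : p < 1) (hμ : μ ≤ 0)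
    (hg : ∀ A ∈ Icc (1 - lam1) (1 + lam0), 1 ≤ g A) {A v : ℝ}
    (hv : v ∈ stepValues u d p lam0 lam1 μ g A) : 1 ≤ v := by
  obtain ⟨α, Au, Ad, hα, hα1, hAu, hAd, -, rfl⟩ := hv
  have hq : 0 < 1 - p := by linarith
  have hα' : 0 < 1 - α := by linarith
  have h1 : p ^ (1 - μ) * α ^ μ ≤ p ^ (1 - μ) * α ^ μ * g Au :=
    le_mul_of_one_le_right (by positivity) (hg Au hAu)
  have h2 : (1 - p) ^ (1 - μ) * (1 - α) ^ μ ≤ (1 - p) ^ (1 - μ) * (1 - α) ^ μ * g Ad :=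
    le_mul_of_one_le_right (by positivity) (hg Ad hAd)
  have := one_le_stepWeight hp hp1 hμ hα hα1
  rw [stepWeight] at this
  linarith

theorem one_le_scaledToGo (hd1 : d < 1) (hu : 1 < u) (hp : 0 < p) (hp1 : p < 1) (hμ : μ ≤ 0)
    (n : ℕ) : ∀ A ∈ Icc (1 - lam1) (1 + lam0), 1 ≤ scaledToGo u d p lam0 lam1 μ n A := by
  induction n with
  | zero => intro A _; exact le_rfl
  | succ n ih =>
    intro A hA
    exact le_csInf (stepValues_nonempty hd1 hu hA)
      fun v hv => one_le_of_mem_stepValues hp hp1 hμ ih hv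

theorem scaledToGo_succ_le (hp : 0 < p) (hp1 : p < 1) (hd1 : d < 1) (hu : 1 < u)
    (hμ : μ ≤ 0) (n : ℕ) {A v : ℝ}
    (hv : v ∈ stepValues u d p lam0 lam1 μ (scaledToGo u d p lam0 lam1 μ n) A) :
    scaledToGo u d p lam0 lam1 μ (n + 1) A ≤ v :=
  csInf_le ⟨1, fun _ hw => one_le_of_mem_stepValues hp hp1 hμ
    (one_le_scaledToGo hd1 hu hp hp1 hμ n) hw⟩ hv

/-- With positive drift the scaled dual value function is nonincreasing. -/
theorem scaledToGo_antitoneOn (hd : 0 < d) (hd1 : d < 1) (hu : 1 < u) (hp : 0 < p) (hp1 : p < 1)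
    (hlam0 : 0 < lam0) (hlam1 : 0 < lam1) (hμ : μ ≤ 0)
    (hdrift : 1 < p * u + (1 - p) * d) (n : ℕ) :
    AntitoneOn (scaledToGo u d p lam0 lam1 μ n) (Icc (1 - lam1) (1 + lam0)) := by
  induction n with
  | zero => intro A _ B _ _; exact le_rfl
  | succ n ih =>
    intro A hA B hB hAB
    refine le_csInf (stepValues_nonempty hd1 hu hA) ?_
    rintro v ⟨α, Au, Ad, hα, hα1, hAu, hAd, hA', rfl⟩
    have hq : 0 < 1 - p := by linarith
    have hα' : 0 < 1 - α := by linarith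
    have hud : 0 < u - d := by linarith
    have htop : 1 + lam0 ∈ Icc (1 - lam1) (1 + lam0) := ⟨by linarith, le_rfl⟩
    -- `N` is the ratio reached when `α` is kept and both successors are moved to the top. If `B ≤
    -- N`, moving both successors part of the way up reaches `B` and lowers both terms by induction.
    -- Otherwise both sit at the top and `α` has to grow as well.
    set N := α * u * (1 + lam0) + (1 - α) * d * (1 + lam0) with hN
    rcases le_or_gt B N with hBN | hBN
    · obtain ⟨t, ht0, ht1, ht⟩ : ∃ t : ℝ, 0 ≤ t ∧ t ≤ 1 ∧ A + t * (N - A) = B := by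
        rcases (hAB.trans hBN).eq_or_lt with h | h
        · exact ⟨0, le_rfl, zero_le_one, by linarith⟩
        · have hNA : 0 < N - A := by linarith
          refine ⟨(B - A) / (N - A), div_nonneg (by linarith) hNA.le, ?_, by field_simp; ring⟩
          rw [div_le_one hNA]; linarith
      have key : ∀ x ∈ Icc (1 - lam1) (1 + lam0), x ≤ x + t * (1 + lam0 - x) ∧
          x + t * (1 + lam0 - x) ∈ Icc (1 - lam1) (1 + lam0) := by
        intro x hx
        have h0 : 0 ≤ t * (1 + lam0 - x) := mul_nonneg ht0 (by linarith [hx.2])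
        have h1 : t * (1 + lam0 - x) ≤ 1 * (1 + lam0 - x) := by
          gcongr; linarith [hx.2]
        exact ⟨by linarith, by linarith [hx.1], by linarith⟩
      refine (scaledToGo_succ_le hp hp1 hd1 hu hμ n ⟨α, _, _, hα, hα1, (key Au hAu).2,
        (key Ad hAd).2, ?_, rfl⟩).trans ?_
      · rw [← ht, hN, ← hA']; ring
      · gcongr
        · exact ih hAu (key Au hAu).2 (key Au hAu).1
        · exact ih hAd (key Ad hAd).2 (key Ad hAd).1
    · have hlam : 0 < 1 + lam0 := by linarith
      set β := (B / (1 + lam0) - d) / (u - d) with hβ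
      have hB1 : B / (1 + lam0) ≤ 1 := by rw [div_le_one hlam]; exact hB.2
      -- Here the drift enters: `β u + (1 - β) d = B / (1 + lam0) ≤ 1 < p u + (1 - p) d`. So `α ≤ β
      -- ≤ p`, and passing from `α` to `β` lowers the weight.
      have hβp : β ≤ p := by
        rw [hβ, div_le_iff₀ hud]; nlinarith
      have hαβ : α ≤ β := by
        rw [hβ, le_div_iff₀ hud, le_sub_iff_add_le, le_div_iff₀ hlam]
        nlinarith
      have hβeq : β * u * (1 + lam0) + (1 - β) * d * (1 + lam0) = B := by
        rw [hβ]; field_simp; ring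
      refine (scaledToGo_succ_le hp hp1 hd1 hu hμ n ⟨β, _, _, by linarith, by linarith, htop,
        htop, hβeq, rfl⟩).trans ?_
      have hw := stepWeight_le_of_mem_segment hp hp1 hμ hα hα1 (β := β)
        (by rw [segment_eq_Icc (hαβ.trans hβp)]; exact ⟨hαβ, hβp⟩)
      have hg := one_le_scaledToGo (lam0 := lam0) (lam1 := lam1) hd1 hu hp hp1 hμ n _ htop
      calc _ = stepWeight p μ β * scaledToGo u d p lam0 lam1 μ n (1 + lam0) := by
            rw [stepWeight]; ring
        _ ≤ stepWeight p μ α * scaledToGo u d p lam0 lam1 μ n (1 + lam0) := by gcongr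
        _ = p ^ (1 - μ) * α ^ μ * scaledToGo u d p lam0 lam1 μ n (1 + lam0) +
            (1 - p) ^ (1 - μ) * (1 - α) ^ μ * scaledToGo u d p lam0 lam1 μ n (1 + lam0) := by
            rw [stepWeight]; ring
        _ ≤ _ := by
          gcongr
          · exact ih hAu htop hAu.2
          · exact ih hAd htop hAd.2

/-- With negative drift the scaled dual value function is nondecreasing. -/
theorem scaledToGo_monotoneOn (hd1 : d < 1) (hu : 1 < u) (hp : 0 < p) (hp1 : p < 1)
    (hlam0 : 0 < lam0) (hlam1 : 0 < lam1) (hlam1' : lam1 < 1) (hμ : μ ≤ 0)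
    (hdrift : p * u + (1 - p) * d < 1) (n : ℕ) :
    MonotoneOn (scaledToGo u d p lam0 lam1 μ n) (Icc (1 - lam1) (1 + lam0)) := by
  induction n with
  | zero => intro A _ B _ _; exact le_rfl
  | succ n ih =>
    intro B hB A hA hAB
    refine le_csInf (stepValues_nonempty hd1 hu hA) ?_
    rintro v ⟨α, Au, Ad, hα, hα1, hAu, hAd, hA', rfl⟩
    have hq : 0 < 1 - p := by linarith
    have hα' : 0 < 1 - α := by linarith
    have hud : 0 < u - d := by linarith
    have hbot : 1 - lam1 ∈ Icc (1 - lam1) (1 + lam0) := ⟨le_rfl, by linarith⟩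
    -- The mirror image: successors move down to `1 - lam1`, and if that is not enough, `α` shrinks
    -- to some `β` with `p ≤ β ≤ α`.
    set N := α * u * (1 - lam1) + (1 - α) * d * (1 - lam1) with hN
    rcases le_or_gt N B with hBN | hBN
    · obtain ⟨t, ht0, ht1, ht⟩ : ∃ t : ℝ, 0 ≤ t ∧ t ≤ 1 ∧ A - t * (A - N) = B := by
        rcases (hBN.trans hAB).eq_or_lt with h | h
        · exact ⟨0, le_rfl, zero_le_one, by linarith⟩
        · have hNA : 0 < A - N := by linarith
          refine ⟨(A - B) / (A - N), div_nonneg (by linarith) hNA.le, ?_, by field_simp; ring⟩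
          rw [div_le_one hNA]; linarith
      have key : ∀ x ∈ Icc (1 - lam1) (1 + lam0), x - t * (x - (1 - lam1)) ≤ x ∧
          x - t * (x - (1 - lam1)) ∈ Icc (1 - lam1) (1 + lam0) := by
        intro x hx
        have h0 : 0 ≤ t * (x - (1 - lam1)) := mul_nonneg ht0 (by linarith [hx.1])
        have h1 : t * (x - (1 - lam1)) ≤ 1 * (x - (1 - lam1)) := by
          gcongr; linarith [hx.1]
        exact ⟨by linarith, by linarith, by linarith [hx.2]⟩
      refine (scaledToGo_succ_le hp hp1 hd1 hu hμ n ⟨α, _, _, hα, hα1, (key Au hAu).2,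
        (key Ad hAd).2, ?_, rfl⟩).trans ?_
      · rw [← ht, hN, ← hA']; ring
      · gcongr
        · exact ih (key Au hAu).2 hAu (key Au hAu).1
        · exact ih (key Ad hAd).2 hAd (key Ad hAd).1
    · have hlam : 0 < 1 - lam1 := by linarith
      set β := (B / (1 - lam1) - d) / (u - d) with hβ
      have hB1 : 1 ≤ B / (1 - lam1) := by rw [le_div_iff₀ hlam]; linarith [hB.1]
      have hβp : p ≤ β := by
        rw [hβ, le_div_iff₀ hud]; nlinarith
      have hαβ : β ≤ α := by
        rw [hβ, div_le_iff₀ hud, sub_le_iff_le_add, div_le_iff₀ hlam]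
        nlinarith
      have hβeq : β * u * (1 - lam1) + (1 - β) * d * (1 - lam1) = B := by
        rw [hβ]; field_simp; ring
      refine (scaledToGo_succ_le hp hp1 hd1 hu hμ n ⟨β, _, _, by linarith, by linarith, hbot,
        hbot, hβeq, rfl⟩).trans ?_
      have hw := stepWeight_le_of_mem_segment hp hp1 hμ hα hα1 (β := β)
        (by rw [segment_symm, segment_eq_Icc (hβp.trans hαβ)]; exact ⟨hβp, hαβ⟩)
      have hg := one_le_scaledToGo (lam0 := lam0) (lam1 := lam1) hd1 hu hp hp1 hμ n _ hbot
      calc _ = stepWeight p μ β * scaledToGo u d p lam0 lam1 μ n (1 - lam1) := by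
            rw [stepWeight]; ring
        _ ≤ stepWeight p μ α * scaledToGo u d p lam0 lam1 μ n (1 - lam1) := by gcongr
        _ = p ^ (1 - μ) * α ^ μ * scaledToGo u d p lam0 lam1 μ n (1 - lam1) +
            (1 - p) ^ (1 - μ) * (1 - α) ^ μ * scaledToGo u d p lam0 lam1 μ n (1 - lam1) := by
            rw [stepWeight]; ring
        _ ≤ _ := by
          gcongr
          · exact ih hbot hAu hAu.1
          · exact ih hbot hAd hAd.1

end ScaledRecursion

/-! ### Transaction costs and first-step decomposition of the market -/

theorem h_eq_max {lam0 lam1 : ℝ} (hlam0 : 0 < lam0) (hlam1 : 0 < lam1) (z : ℝ) :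
    h lam0 lam1 z = max ((1 + lam0) * z) ((1 - lam1) * z) := by
  unfold h
  split_ifs with hz
  · rw [max_eq_left]; nlinarith
  · rw [max_eq_right]; nlinarith

/-- Trading without costs at a price in the bid-ask interval is never worse than the actual terms;
hence every such `R` is dual feasible. -/
theorem mul_le_h {lam0 lam1 R : ℝ} (hlam0 : 0 < lam0) (hlam1 : 0 < lam1)
    (hR : R ∈ Icc (1 - lam1) (1 + lam0)) (z : ℝ) : z * R ≤ h lam0 lam1 z := by
  rw [h_eq_max hlam0 hlam1]
  rcases le_total 0 z with hz | hz
  · exact le_max_of_le_left (by nlinarith [hR.2])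
  · exact le_max_of_le_right (by nlinarith [hR.1])

theorem continuous_h {lam0 lam1 : ℝ} (hlam0 : 0 < lam0) (hlam1 : 0 < lam1) :
    Continuous (h lam0 lam1) := by
  rw [show h lam0 lam1 = _ from funext (h_eq_max hlam0 hlam1)]
  fun_prop

theorem h_convex {lam0 lam1 : ℝ} (hlam0 : 0 < lam0) (hlam1 : 0 < lam1) {a b : ℝ} (ha : 0 ≤ a)
    (hb : 0 ≤ b) (y z : ℝ) :
    h lam0 lam1 (a * y + b * z) ≤ a * h lam0 lam1 y + b * h lam0 lam1 z := by
  have hI : 1 + lam0 ∈ Icc (1 - lam1) (1 + lam0) := ⟨by linarith, le_rfl⟩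
  have hI' : 1 - lam1 ∈ Icc (1 - lam1) (1 + lam0) := ⟨le_rfl, by linarith⟩
  rw [h_eq_max hlam0 hlam1 (a * y + b * z)]
  apply max_le
  · nlinarith [mul_le_h hlam0 hlam1 hI y, mul_le_h hlam0 hlam1 hI z]
  · nlinarith [mul_le_h hlam0 hlam1 hI' y, mul_le_h hlam0 hlam1 hI' z]

theorem factor_pos {u d : ℝ} (hd : 0 < d) (hu : 1 < u) (b : Bool) : 0 < factor u d b := by
  unfold factor; split_ifs <;> linarith

theorem price_pos {T : ℕ} {u d S : ℝ} (hd : 0 < d) (hu : 1 < u) (hS : 0 < S) (k : ℕ)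
    (ω : Path T) : 0 < price u d S k ω :=
  mul_pos hS (Finset.prod_pos fun _ _ => factor_pos hd hu _)

theorem price_zero {T : ℕ} (u d S : ℝ) (ω : Path T) : price u d S 0 ω = S := by
  simp [price]

/-- The cash obtained by liquidating the position `(x0, x1)` at the stock price `S`. -/
noncomputable def liquidationValue (lam0 lam1 S x0 x1 : ℝ) : ℝ := x0 - h lam0 lam1 (-x1) * S

theorem liquidation_eq {T : ℕ} (u d S lam0 lam1 x0 x1 : ℝ) (I : ℕ → Path T → ℝ) (k : ℕ)
    (ω : Path T) :
    liquidation u d S lam0 lam1 x0 x1 I k ω =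
      liquidationValue lam0 lam1 (price u d S k ω) (cash u d S lam0 lam1 x0 I k ω)
        (shares x1 I k ω) := rfl

theorem liquidationValue_le {lam0 lam1 S R : ℝ} (hlam0 : 0 < lam0) (hlam1 : 0 < lam1) (hS : 0 ≤ S)
    (hR : R ∈ Icc (1 - lam1) (1 + lam0)) (x0 x1 : ℝ) :
    liquidationValue lam0 lam1 S x0 x1 ≤ x0 + x1 * S * R := by
  have := mul_le_h hlam0 hlam1 hR (-x1)
  unfold liquidationValue
  nlinarith

theorem liquidationValue_eq_min {lam0 lam1 S : ℝ} (hlam0 : 0 < lam0) (hlam1 : 0 < lam1) (hS : 0 ≤ S)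
    (x0 x1 : ℝ) :
    liquidationValue lam0 lam1 S x0 x1 =
      min (x0 + x1 * S * (1 - lam1)) (x0 + x1 * S * (1 + lam0)) := by
  apply le_antisymm
  · exact le_min (liquidationValue_le hlam0 hlam1 hS ⟨le_rfl, by linarith⟩ x0 x1)
      (liquidationValue_le hlam0 hlam1 hS ⟨by linarith, le_rfl⟩ x0 x1)
  · unfold liquidationValue h
    split_ifs with hx
    · exact (min_le_right _ _).trans (by nlinarith)
    · exact (min_le_left _ _).trans (by nlinarith)

theorem price_succ_cons {n : ℕ} (u d S : ℝ) (k : ℕ) (b : Bool) (ω : Path n) :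
    price u d S (k + 1) (Fin.cons b ω : Path (n + 1)) = price u d (S * factor u d b) k ω := by
  simp only [price, Finset.prod_filter, Fin.prod_univ_succ, Fin.cons_zero, Fin.cons_succ,
    Fin.val_zero, Fin.val_succ, Nat.zero_lt_succ, if_true, add_lt_add_iff_right, mul_assoc]

theorem prob_eq_prod {n : ℕ} (p : ℝ) (ω : Path n) :
    prob p ω = ∏ i, if ω i = true then p else 1 - p := by
  rw [Finset.prod_ite, Finset.prod_const, Finset.prod_const, prob]
  congr 2
  have := Finset.card_filter_add_card_filter_not (s := (Finset.univ : Finset (Fin n)))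
    (fun i => ω i = true)
  rw [Finset.card_univ, Fintype.card_fin] at this
  omega

theorem prob_nonneg {n : ℕ} {p : ℝ} (hp : 0 < p) (hp1 : p < 1) (ω : Path n) : 0 ≤ prob p ω := by
  have : 0 < 1 - p := by linarith
  unfold prob; positivity

theorem expect_succ {n : ℕ} (p : ℝ) (f : Path (n + 1) → ℝ) :
    expect p f = p * expect p (fun ω : Path n => f (Fin.cons true ω)) +
      (1 - p) * expect p (fun ω : Path n => f (Fin.cons false ω)) := by
  have h1 : ∀ (b : Bool) (ω : Path n), prob p (Fin.cons b ω : Path (n + 1)) =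
      (if b = true then p else 1 - p) * prob p ω := by
    intro b ω
    simp only [prob_eq_prod, Fin.prod_univ_succ, Fin.cons_zero, Fin.cons_succ]
  unfold expect
  rw [← Equiv.sum_comp (Fin.consEquiv fun _ : Fin (n + 1) => Bool), Fintype.sum_prod_type,
    Fintype.sum_bool, Finset.mul_sum, Finset.mul_sum]
  congr 1 <;> refine Finset.sum_congr rfl fun ω _ => ?_
  · change prob p (Fin.cons true ω : Path (n + 1)) * f (Fin.cons true ω) = _
    rw [h1, if_pos rfl, mul_assoc]
  · change prob p (Fin.cons false ω : Path (n + 1)) * f (Fin.cons false ω) = _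
    rw [h1, if_neg (by simp), mul_assoc]

theorem expect_zero (p : ℝ) (f : Path 0 → ℝ) : expect p f = f default := by
  simp only [expect, prob, Fintype.sum_unique]
  simp
  exact congrArg f (Subsingleton.elim _ _)

theorem expect_mono {n : ℕ} {p : ℝ} (hp : 0 < p) (hp1 : p < 1) {f g : Path n → ℝ}
    (hfg : ∀ ω, f ω ≤ g ω) : expect p f ≤ expect p g :=
  Finset.sum_le_sum fun ω _ => mul_le_mul_of_nonneg_left (hfg ω) (prob_nonneg hp hp1 ω)

theorem expect_const {n : ℕ} (p c : ℝ) : expect p (fun _ : Path n => c) = c := by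
  induction n with
  | zero => rw [expect_zero]
  | succ n ih => rw [expect_succ, ih]; ring

theorem expect_add_smul {n : ℕ} (p a b : ℝ) (f g : Path n → ℝ) :
    expect p (fun ω => a * f ω + b * g ω) = a * expect p f + b * expect p g := by
  simp only [expect, Finset.mul_sum, ← Finset.sum_add_distrib]
  exact Finset.sum_congr rfl fun ω _ => by ring

/-- The continuation of a strategy after the first move `b`. -/
def tailStrategy {n : ℕ} (I : ℕ → Path (n + 1) → ℝ) (b : Bool) : ℕ → Path n → ℝ :=
  fun k ω => I (k + 1) (Fin.cons b ω)

/-- The strategy that waits for the first move `b` and then follows `J b`. -/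
def waitStrategy {n : ℕ} (J : Bool → ℕ → Path n → ℝ) : ℕ → Path (n + 1) → ℝ
  | 0, _ => 0
  | k + 1, ω => J (ω 0) k (Fin.tail ω)

theorem tailStrategy_waitStrategy {n : ℕ} (J : Bool → ℕ → Path n → ℝ) (b : Bool) :
    tailStrategy (waitStrategy J) b = J b := by
  funext k ω
  simp [tailStrategy, waitStrategy]

theorem liquidation_zero {n : ℕ} (u d S lam0 lam1 x0 x1 : ℝ) (I : ℕ → Path n → ℝ) (ω : Path n) :
    liquidation u d S lam0 lam1 x0 x1 I 0 ω =
      liquidationValue lam0 lam1 S (x0 - h lam0 lam1 (I 0 ω) * S) (x1 + I 0 ω) := by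
  simp [liquidation, liquidationValue, cash, shares, price_zero]

/-- After the first trade and the first move the problem restarts with one period less, a new price
and a new position. The inductions over strategies rest on this. -/
theorem liquidation_succ_cons {n : ℕ} (u d S lam0 lam1 x0 x1 : ℝ) {z : ℝ}
    {I : ℕ → Path (n + 1) → ℝ} (hz : ∀ ω, I 0 ω = z) (k : ℕ) (b : Bool) (ω : Path n) :
    liquidation u d S lam0 lam1 x0 x1 I (k + 1) (Fin.cons b ω : Path (n + 1)) =
      liquidation u d (S * factor u d b) lam0 lam1 (x0 - h lam0 lam1 z * S) (x1 + z)
        (tailStrategy I b) k ω := by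
  have h1 : cash u d S lam0 lam1 x0 I (k + 1) (Fin.cons b ω : Path (n + 1)) =
      cash u d (S * factor u d b) lam0 lam1 (x0 - h lam0 lam1 z * S) (tailStrategy I b) k ω := by
    simp only [cash, tailStrategy]
    rw [Finset.sum_range_succ' _ (k + 1), hz, price_zero]
    simp only [price_succ_cons]
    ring
  have h2 : shares x1 I (k + 1) (Fin.cons b ω : Path (n + 1)) =
      shares (x1 + z) (tailStrategy I b) k ω := by
    simp only [shares, tailStrategy]
    rw [Finset.sum_range_succ' _ (k + 1), hz]
    ring
  rw [liquidation, liquidation, h1, h2, price_succ_cons]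

theorem IsAdapted.zero_const {n : ℕ} {I : ℕ → Path n → ℝ} (hI : IsAdapted I) (ω : Path n) :
    I 0 ω = I 0 fun _ => true :=
  hI 0 (Nat.zero_le _) _ _ fun _ hi => absurd hi (Nat.not_lt_zero _)

theorem IsAdmissible.tailStrategy {n : ℕ} {u d S lam0 lam1 x0 x1 z : ℝ}
    {I : ℕ → Path (n + 1) → ℝ} (hI : IsAdmissible u d S lam0 lam1 x0 x1 I)
    (hz : ∀ ω, I 0 ω = z) (b : Bool) :
    IsAdmissible u d (S * factor u d b) lam0 lam1 (x0 - h lam0 lam1 z * S) (x1 + z)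
      (tailStrategy I b) := by
  refine ⟨fun k hk ω ω' hω => hI.1 (k + 1) (by omega) _ _ fun i hi => ?_, fun k hk ω => ?_⟩
  · refine Fin.cases (fun _ => rfl) (fun j hj => ?_) i hi
    simp only [Fin.cons_succ]
    exact hω j (by simpa using hj)
  · rw [← liquidation_succ_cons u d S lam0 lam1 x0 x1 hz]
    exact hI.2 (k + 1) (by omega) _

theorem h_zero (lam0 lam1 : ℝ) : h lam0 lam1 0 = 0 := by simp [h]

theorem isAdmissible_waitStrategy {n : ℕ} {u d S lam0 lam1 x0 x1 : ℝ}
    {J : Bool → ℕ → Path n → ℝ}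
    (hJ : ∀ b, IsAdmissible u d (S * factor u d b) lam0 lam1 x0 x1 (J b))
    (hx : 0 ≤ liquidationValue lam0 lam1 S x0 x1) :
    IsAdmissible u d S lam0 lam1 x0 x1 (waitStrategy J) := by
  refine ⟨fun k hk ω ω' hω => ?_, fun k hk ω => ?_⟩
  · cases k with
    | zero => rfl
    | succ k =>
      have h0 : ω 0 = ω' 0 := hω 0 (by simp)
      simp only [waitStrategy, h0]
      exact (hJ (ω' 0)).1 k (by omega) _ _ fun i hi => hω i.succ (by simpa using hi)
  · cases k with
    | zero => rw [liquidation_zero]; simpa [waitStrategy, h_zero] using hx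
    | succ k =>
      rw [← Fin.cons_self_tail ω, liquidation_succ_cons u d S lam0 lam1 x0 x1 (z := 0)
        (fun _ => rfl), tailStrategy_waitStrategy]
      simpa [h_zero] using (hJ (ω 0)).2 k (by omega) (Fin.tail ω)

/-! ### Weak duality -/

section WeakDuality

variable {u d p lam0 lam1 γ : ℝ}

/-- Homogeneity of the conjugate: a branch of probability `p` with multiplier `yα/p` contributes
exactly its weight in the scaled recursion. -/
theorem mul_div_rpow {p μ α y : ℝ} (hp : 0 < p) (hα : 0 < α) (hy : 0 < y) :
    p * (y * α / p) ^ μ = y ^ μ * (p ^ (1 - μ) * α ^ μ) := by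
  rw [Real.div_rpow (by positivity) hp.le, Real.mul_rpow hy.le hα.le, Real.rpow_sub hp,
    Real.rpow_one]
  ring

/-- Weak duality: every dual variable bounds the expected utility of every strategy. -/
theorem expect_powerUtility_le (hd : 0 < d) (hd1 : d < 1) (hu : 1 < u) (hp : 0 < p) (hp1 : p < 1)
    (hlam0 : 0 < lam0) (hlam1 : 0 < lam1) (hγ : 0 < γ) (hγ1 : γ < 1) (n : ℕ) :
    ∀ (S x0 x1 : ℝ) (I : ℕ → Path n → ℝ) (y R : ℝ), 0 < S →
      IsAdmissible u d S lam0 lam1 x0 x1 I → 0 < y → R ∈ Icc (1 - lam1) (1 + lam0) →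
      expect p (fun ω => powerUtility γ (liquidation u d S lam0 lam1 x0 x1 I n ω)) ≤
        y * (x0 + x1 * S * R) + (1 / γ - 1) *
          (y ^ (γ / (γ - 1)) * scaledToGo u d p lam0 lam1 (γ / (γ - 1)) n R) := by
  have hc : 0 < 1 / γ - 1 := by
    rw [sub_pos, lt_div_iff₀ hγ]; linarith
  induction n with
  | zero =>
    intro S x0 x1 I y R hS hI hy hR
    rw [expect_zero]
    have hL := hI.2 0 le_rfl default
    have h1 := powerUtility_le_conjugate hγ hγ1 hL hy zero_le_one
    rw [Real.one_rpow, mul_one] at h1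
    have h2 := liquidationValue_le hlam0 hlam1 hS.le hR (x0 - h lam0 lam1 (I 0 default) * S)
      (x1 + I 0 default)
    rw [← liquidation_zero] at h2
    have h3 := mul_le_h hlam0 hlam1 hR (I 0 default)
    have h4 : liquidation u d S lam0 lam1 x0 x1 I 0 default ≤ x0 + x1 * S * R := by nlinarith
    rw [powerUtility, div_eq_inv_mul, ← one_div]
    refine h1.trans ?_
    simp only [scaledToGo]
    gcongr
  | succ n ih =>
    intro S x0 x1 I y R hS hI hy hR
    have hq : 0 < 1 - p := by linarith
    obtain ⟨z, hz⟩ : ∃ z, ∀ ω, I 0 ω = z := ⟨_, hI.1.zero_const⟩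
    have hy' : 0 < y ^ (γ / (γ - 1)) := Real.rpow_pos_of_pos hy _
    -- The infimum is isolated, so that the bound need only be checked for each feasible `(α, Au,
    -- Ad)`.
    rw [← sub_le_iff_le_add', ← mul_assoc, ← div_le_iff₀' (mul_pos hc hy')]
    refine le_csInf (stepValues_nonempty hd1 hu hR) ?_
    rintro v ⟨α, Au, Ad, hα, hα1, hAu, hAd, hA, rfl⟩
    have hα' : 0 < 1 - α := by linarith
    rw [div_le_iff₀' (mul_pos hc hy'), sub_le_iff_le_add', expect_succ]
    simp only [liquidation_succ_cons u d S lam0 lam1 x0 x1 hz]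
    have eu := ih _ _ _ _ (y * α / p) Au (mul_pos hS (factor_pos hd hu true))
      (hI.tailStrategy hz true) (by positivity) hAu
    have ed := ih _ _ _ _ (y * (1 - α) / (1 - p)) Ad (mul_pos hS (factor_pos hd hu false))
      (hI.tailStrategy hz false) (by positivity) hAd
    have h3 := mul_le_h hlam0 hlam1 hR z
    have wu := mul_div_rpow (μ := γ / (γ - 1)) hp hα hy
    have wd := mul_div_rpow (μ := γ / (γ - 1)) hq hα' hy
    have eu' := mul_le_mul_of_nonneg_left eu hp.le
    have ed' := mul_le_mul_of_nonneg_left ed hq.le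
    have fu : factor u d true = u := rfl
    have fd : factor u d false = d := rfl
    refine (add_le_add eu' ed').trans ?_
    rw [fu, fd]
    set gu := scaledToGo u d p lam0 lam1 (γ / (γ - 1)) n Au
    set gd := scaledToGo u d p lam0 lam1 (γ / (γ - 1)) n Ad
    set x0' := x0 - h lam0 lam1 z * S with hx0'
    have e : p * (y * α / p * (x0' + (x1 + z) * (S * u) * Au) +
        (1 / γ - 1) * ((y * α / p) ^ (γ / (γ - 1)) * gu)) +
        (1 - p) * (y * (1 - α) / (1 - p) * (x0' + (x1 + z) * (S * d) * Ad) +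
        (1 / γ - 1) * ((y * (1 - α) / (1 - p)) ^ (γ / (γ - 1)) * gd)) =
        y * (x0' + (x1 + z) * S * (α * u * Au + (1 - α) * d * Ad)) +
        (1 / γ - 1) * ((p * (y * α / p) ^ (γ / (γ - 1))) * gu +
          ((1 - p) * (y * (1 - α) / (1 - p)) ^ (γ / (γ - 1))) * gd) := by
      have e1 : p * (y * α / p) = y * α := by field_simp
      have e2 : (1 - p) * (y * (1 - α) / (1 - p)) = y * (1 - α) := by field_simp
      linear_combination (x0' + (x1 + z) * (S * u) * Au) * e1 +
        (x0' + (x1 + z) * (S * d) * Ad) * e2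
    rw [e, wu, wd, hA]
    have h5 : x0' + (x1 + z) * S * R ≤ x0 + x1 * S * R := by
      rw [hx0']; nlinarith
    have h6 := mul_le_mul_of_nonneg_left h5 hy.le
    refine (add_le_add_left h6 _).trans (le_of_eq ?_)
    ring

end WeakDuality

/-! ### Existence of an optimal strategy -/

section Attainment

variable {u d p S lam0 lam1 x0 x1 γ : ℝ}

/-- The trades of admissible strategies are uniformly bounded. -/
theorem exists_trade_bound (hd : 0 < d) (hd1 : d < 1) (hu : 1 < u)
    (hlam0 : 0 < lam0) (hlam1 : 0 < lam1) (n : ℕ) :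
    ∀ S W : ℝ, 0 < S → 0 ≤ W → ∃ B : ℝ, ∀ (x0 x1 : ℝ) (I : ℕ → Path n → ℝ),
      IsAdmissible u d S lam0 lam1 x0 x1 I → |x1| ≤ W → x0 + x1 * S ≤ W →
      ∀ k ≤ n, ∀ ω, |I k ω| ≤ B := by
  have hI1 : (1 : ℝ) ∈ Icc (1 - lam1) (1 + lam0) := ⟨by linarith, by linarith⟩
  set m := min lam0 lam1 with hm
  have hm0 : 0 < m := lt_min hlam0 hlam1
  -- Trading cannot raise the wealth marked at the ratio `1`. Liquidation costs at least `m * S` per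
  -- share held or owed, so solvency bounds the position by wealth.
  have key : ∀ S W x0 x1 z : ℝ, 0 < S → 0 ≤ W → x0 + x1 * S ≤ W →
      0 ≤ liquidationValue lam0 lam1 S (x0 - h lam0 lam1 z * S) (x1 + z) →
      |x1 + z| ≤ W / (m * S) ∧ x0 - h lam0 lam1 z * S + (x1 + z) * S ≤ W := by
    intro S W x0 x1 z hS hW hx hL
    have h3 := mul_le_h hlam0 hlam1 hI1 z
    have hW' : x0 - h lam0 lam1 z * S + (x1 + z) * S ≤ W := by nlinarith
    rw [liquidationValue_eq_min hlam0 hlam1 hS.le, le_min_iff] at hL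
    refine ⟨?_, hW'⟩
    rw [le_div_iff₀ (mul_pos hm0 hS)]
    rcases le_total 0 (x1 + z) with hs | hs
    · rw [abs_of_nonneg hs]
      have : (x1 + z) * (m * S) ≤ (x1 + z) * (lam1 * S) := by
        gcongr; exact min_le_right _ _
      nlinarith [hL.1]
    · rw [abs_of_nonpos hs]
      have : -(x1 + z) * (m * S) ≤ -(x1 + z) * (lam0 * S) := by
        have : 0 ≤ -(x1 + z) := by linarith
        gcongr; exact min_le_left _ _
      nlinarith [hL.2]
  have trade : ∀ S W x0 x1 z : ℝ, |x1| ≤ W → |x1 + z| ≤ W / (m * S) →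
      |z| ≤ W / (m * S) + W := by
    intro S W x0 x1 z h1 h2
    calc |z| = |(x1 + z) - x1| := by ring_nf
      _ ≤ |x1 + z| + |x1| := abs_sub _ _
      _ ≤ _ := add_le_add h2 h1
  induction n with
  | zero =>
    intro S W hS hW
    refine ⟨W / (m * S) + W, fun x0 x1 I hI hx1 hx k hk ω => ?_⟩
    obtain rfl : k = 0 := by omega
    have hL := hI.2 0 le_rfl ω
    rw [liquidation_zero] at hL
    exact trade S W x0 x1 _ hx1 (key S W x0 x1 _ hS hW hx hL).1
  | succ n ih =>
    intro S W hS hW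
    have hW1 : 0 ≤ W / (m * S) := by positivity
    -- `W'` bounds both the new holdings and the wealth after the price move, which changes by at
    -- most `|x1 + z| * S * u`.
    set W' := W + W / (m * S) + W / (m * S) * S * u with hW'
    have hWW' : 0 ≤ W' := by
      have : 0 ≤ W / (m * S) * S * u := by positivity
      linarith
    choose B hB using fun b : Bool => ih (S * factor u d b) W'
      (mul_pos hS (factor_pos hd hu b)) hWW'
    refine ⟨max (W / (m * S) + W) (max (B true) (B false)),
      fun x0 x1 I hI hx1 hx k hk ω => ?_⟩
    obtain ⟨z, hz⟩ : ∃ z, ∀ ω, I 0 ω = z := ⟨_, hI.1.zero_const⟩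
    have hL := hI.2 0 (Nat.zero_le _) ω
    rw [liquidation_zero, hz] at hL
    obtain ⟨k1, k2⟩ := key S W x0 x1 z hS hW hx hL
    cases k with
    | zero =>
      rw [hz]
      exact le_max_of_le_left (trade S W x0 x1 z hx1 k1)
    | succ k =>
      refine le_max_of_le_right ?_
      have hf : |factor u d (ω 0) - 1| ≤ u := by
        unfold factor
        split_ifs <;> rw [abs_le] <;> constructor <;> linarith
      have hpos : 0 ≤ W / (m * S) * S * u := by positivity
      have := hB (ω 0) _ _ _ (hI.tailStrategy hz (ω 0)) (k1.trans (by linarith)) (by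
        have e : (x1 + z) * S * (factor u d (ω 0) - 1) ≤ W / (m * S) * S * u := by
          refine (le_abs_self _).trans ?_
          rw [abs_mul, abs_mul, abs_of_pos hS]
          gcongr
        have e2 : x0 - h lam0 lam1 z * S + (x1 + z) * (S * factor u d (ω 0)) =
          x0 - h lam0 lam1 z * S + (x1 + z) * S + (x1 + z) * S * (factor u d (ω 0) - 1) := by ring
        rw [e2]
        linarith) k (by omega) (Fin.tail ω)
      rw [tailStrategy, Fin.cons_self_tail] at this
      refine this.trans ?_
      cases ω 0
      · exact le_max_right _ _
      · exact le_max_left _ _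

/-- The strategy that liquidates the position at time `0` is admissible. -/
theorem exists_admissible_const {n : ℕ} (hx : 0 ≤ liquidationValue lam0 lam1 S x0 x1) :
    ∃ I : ℕ → Path n → ℝ, IsAdmissible u d S lam0 lam1 x0 x1 I ∧
      ∀ k ω, liquidation u d S lam0 lam1 x0 x1 I k ω = liquidationValue lam0 lam1 S x0 x1 := by
  have hL : ∀ (k : ℕ) (ω : Path n), liquidation u d S lam0 lam1 x0 x1
      (fun k _ => if k = 0 then -x1 else 0) k ω = liquidationValue lam0 lam1 S x0 x1 := by
    intro k ω
    simp only [liquidation, cash, shares, liquidationValue, Finset.sum_range_succ']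
    simp [h_zero, price_zero]
  exact ⟨_, ⟨fun _ _ _ _ _ => rfl, fun k _ ω => (hL k ω).symm ▸ hx⟩, hL⟩

theorem liquidation_congr {n : ℕ} {I J : ℕ → Path n → ℝ} {k : ℕ}
    (hIJ : ∀ l ≤ k, I l = J l) (ω : Path n) :
    liquidation u d S lam0 lam1 x0 x1 I k ω = liquidation u d S lam0 lam1 x0 x1 J k ω := by
  have e : ∀ l ∈ Finset.range (k + 1), I l = J l := fun l hl =>
    hIJ l (by have := Finset.mem_range.1 hl; omega)
  have h1 : cash u d S lam0 lam1 x0 I k ω = cash u d S lam0 lam1 x0 J k ω := by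
    unfold cash
    rw [Finset.sum_congr rfl fun l hl => by rw [e l hl]]
  have h2 : shares x1 I k ω = shares x1 J k ω := by
    unfold shares
    rw [Finset.sum_congr rfl fun l hl => by rw [e l hl]]
  rw [liquidation, h1, h2, liquidation]

theorem continuous_liquidation {n : ℕ} (hlam0 : 0 < lam0) (hlam1 : 0 < lam1) (k : ℕ)
    (ω : Path n) :
    Continuous fun I : ℕ → Path n → ℝ => liquidation u d S lam0 lam1 x0 x1 I k ω := by
  have hh := continuous_h hlam0 hlam1
  unfold liquidation cash shares
  fun_prop

/-- An optimal strategy exists. -/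
theorem exists_isGreatest_expectedUtilities (hd : 0 < d) (hd1 : d < 1) (hu : 1 < u)
    (hlam0 : 0 < lam0) (hlam1 : 0 < lam1) (hγ : 0 < γ) (hS : 0 < S) (n : ℕ)
    (hx : 0 ≤ liquidationValue lam0 lam1 S x0 x1) :
    ∃ v, IsGreatest (expectedUtilities n u d p S lam0 lam1 (powerUtility γ) x0 x1) v := by
  obtain ⟨B, hB⟩ := exists_trade_bound hd hd1 hu hlam0 hlam1 n S (max |x1| (x0 + x1 * S)) hS
    (le_max_of_le_left (abs_nonneg _))
  have hB' := fun I hI => hB x0 x1 I hI (le_max_left _ _) (le_max_right _ _)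
  -- `K` is compact by Tychonoff. Admissibility leaves trades after time `n` free, so strategies are
  -- truncated there to land in `K`.
  set K : Set (ℕ → Path n → ℝ) := (univ.pi fun _ => univ.pi fun _ => Icc (-|B|) |B|) ∩
    {I | IsAdmissible u d S lam0 lam1 x0 x1 I} with hK
  have hcl : IsClosed {I : ℕ → Path n → ℝ | IsAdmissible u d S lam0 lam1 x0 x1 I} := by
    have hL := continuous_liquidation (u := u) (d := d) (S := S) (x0 := x0) (x1 := x1) (n := n)
      hlam0 hlam1
    unfold IsAdmissible IsAdapted
    simp only [ofPred_and, ofPred_forall]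
    refine IsClosed.inter ?_ ?_
    · refine isClosed_iInter fun k => isClosed_iInter fun _ => isClosed_iInter fun ω =>
        isClosed_iInter fun ω' => isClosed_iInter fun _ => isClosed_eq ?_ ?_ <;> fun_prop
    · exact isClosed_iInter fun k => isClosed_iInter fun _ => isClosed_iInter fun ω =>
        isClosed_le continuous_const (hL k ω)
  have hKc : IsCompact K :=
    (isCompact_univ_pi fun _ => isCompact_univ_pi fun _ => isCompact_Icc).inter_right hcl
  have htrunc : ∀ I : ℕ → Path n → ℝ, IsAdmissible u d S lam0 lam1 x0 x1 I →
      (fun k => if k ≤ n then I k else 0) ∈ K := by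
    intro I hI
    refine ⟨fun k _ ω _ => ?_, fun k hk ω ω' hω => ?_, fun k hk ω => ?_⟩
    · change _ ∈ Icc (-|B|) |B|
      rw [mem_Icc, ← abs_le]
      beta_reduce
      split_ifs with hk
      · exact (hB' I hI k hk ω).trans (le_abs_self B)
      · simp
    · simp only [if_pos hk]
      exact hI.1 k hk ω ω' hω
    · rw [liquidation_congr (J := I) fun l hl => if_pos (hl.trans hk)]
      exact hI.2 k hk ω
  obtain ⟨I0, hI0, -⟩ := exists_admissible_const (n := n) (u := u) (d := d) hx
  have hcont : Continuous fun I : ℕ → Path n → ℝ =>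
      expect p fun ω => powerUtility γ (liquidation u d S lam0 lam1 x0 x1 I n ω) := by
    have hL := continuous_liquidation (u := u) (d := d) (S := S) (x0 := x0) (x1 := x1) (n := n)
      hlam0 hlam1 n
    unfold expect powerUtility
    exact continuous_finsetSum _ fun ω _ => continuous_const.mul
      (((Real.continuous_rpow_const hγ.le).comp (hL ω)).div_const _)
  obtain ⟨I, hIK, hmax⟩ := hKc.exists_isMaxOn ⟨_, htrunc I0 hI0⟩ hcont.continuousOn
  refine ⟨_, ⟨I, hIK.2, rfl⟩, ?_⟩
  rintro v ⟨J, hJ, rfl⟩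
  have := hmax (htrunc J hJ)
  refine le_trans (le_of_eq ?_) this
  congr 1
  funext ω
  rw [liquidation_congr fun l hl => (if_pos hl).symm]

end Attainment

/-! ### Concavity and the solvency region -/

/-- `h` is sublinear, so `a + b = 1` is not required; `b = 0` gives the scaling argument in
`dual_mem_of_value_le`. -/
theorem liquidationValue_concave {lam0 lam1 S a b : ℝ} (hlam0 : 0 < lam0) (hlam1 : 0 < lam1)
    (hS : 0 ≤ S) (ha : 0 ≤ a) (hb : 0 ≤ b) (x0 x1 y0 y1 : ℝ) :
    a * liquidationValue lam0 lam1 S x0 x1 + b * liquidationValue lam0 lam1 S y0 y1 ≤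
      liquidationValue lam0 lam1 S (a * x0 + b * y0) (a * x1 + b * y1) := by
  have := h_convex hlam0 hlam1 ha hb (-x1) (-y1)
  rw [show a * -x1 + b * -y1 = -(a * x1 + b * y1) by ring] at this
  unfold liquidationValue
  nlinarith

theorem liquidationValue_mono {lam0 lam1 S x0 y0 : ℝ} (hxy : x0 ≤ y0) (x1 : ℝ) :
    liquidationValue lam0 lam1 S x0 x1 ≤ liquidationValue lam0 lam1 S y0 x1 :=
  sub_le_sub_right hxy _

/-- The positions with positive liquidation value. -/
def solvencyRegion (lam0 lam1 S : ℝ) : Set (ℝ × ℝ) :=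
  {x | 0 < liquidationValue lam0 lam1 S x.1 x.2}

theorem isOpen_solvencyRegion {lam0 lam1 : ℝ} (hlam0 : 0 < lam0) (hlam1 : 0 < lam1) (S : ℝ) :
    IsOpen (solvencyRegion lam0 lam1 S) := by
  have hh := continuous_h hlam0 hlam1
  refine isOpen_lt continuous_const ?_
  unfold liquidationValue
  fun_prop

theorem convex_solvencyRegion {lam0 lam1 S : ℝ} (hlam0 : 0 < lam0) (hlam1 : 0 < lam1)
    (hS : 0 ≤ S) : Convex ℝ (solvencyRegion lam0 lam1 S) := by
  intro x hx y hy a b ha hb hab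
  refine lt_of_lt_of_le ?_
    (liquidationValue_concave hlam0 hlam1 hS ha hb x.1 x.2 y.1 y.2)
  have hx : 0 < liquidationValue lam0 lam1 S x.1 x.2 := hx
  have hy : 0 < liquidationValue lam0 lam1 S y.1 y.2 := hy
  rcases ha.eq_or_lt with rfl | ha
  · obtain rfl : b = 1 := by linarith
    linarith
  · nlinarith [mul_pos ha hx, mul_nonneg hb hy.le]

/-- A position that is solvent after both moves is solvent before. -/
theorem solvencyRegion_inter_subset {u d lam0 lam1 S : ℝ} (hd1 : d < 1) (hu : 1 < u)
    (hd : 0 < d) (hS : 0 < S) (hlam0 : 0 < lam0) (hlam1 : 0 < lam1) (hlam1' : lam1 < 1) :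
    solvencyRegion lam0 lam1 (S * u) ∩ solvencyRegion lam0 lam1 (S * d) ⊆
      solvencyRegion lam0 lam1 S := by
  rintro x ⟨h1, h2⟩
  simp only [solvencyRegion, mem_ofPred_eq] at h1 h2 ⊢
  have hSu : 0 < S * u := by positivity
  have hSd : 0 < S * d := by positivity
  rw [liquidationValue_eq_min hlam0 hlam1 (by positivity), lt_min_iff] at h1 h2 ⊢
  -- A long position is worth at least as much at `S` as at `S * d`, a short one at least as much as
  -- at `S * u`.
  have key : ∀ R, 0 < R → 0 < x.1 + x.2 * (S * u) * R → 0 < x.1 + x.2 * (S * d) * R →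
      0 < x.1 + x.2 * S * R := by
    intro R hR e1 e2
    have hSR := mul_pos hS hR
    rcases le_total 0 x.2 with h | h
    · have : 0 ≤ x.2 * (S * R) := by positivity
      nlinarith
    · have : x.2 * (S * R) ≤ 0 := mul_nonpos_of_nonpos_of_nonneg h hSR.le
      nlinarith
  exact ⟨key _ (by linarith) h1.1 h2.1, key _ (by linarith) h1.2 h2.2⟩

theorem liquidation_concave {n : ℕ} {u d S lam0 lam1 a b : ℝ} (hd : 0 < d) (hu : 1 < u)
    (hS : 0 < S) (hlam0 : 0 < lam0) (hlam1 : 0 < lam1) (ha : 0 ≤ a) (hb : 0 ≤ b)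
    (x0 x1 y0 y1 : ℝ) (I J : ℕ → Path n → ℝ) (k : ℕ) (ω : Path n) :
    a * liquidation u d S lam0 lam1 x0 x1 I k ω + b * liquidation u d S lam0 lam1 y0 y1 J k ω ≤
      liquidation u d S lam0 lam1 (a * x0 + b * y0) (a * x1 + b * y1)
        (fun k ω => a * I k ω + b * J k ω) k ω := by
  have hc : a * cash u d S lam0 lam1 x0 I k ω + b * cash u d S lam0 lam1 y0 J k ω ≤
      cash u d S lam0 lam1 (a * x0 + b * y0) (fun k ω => a * I k ω + b * J k ω) k ω := by
    have : ∑ l ∈ Finset.range (k + 1), h lam0 lam1 (a * I l ω + b * J l ω) * price u d S l ω ≤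
        a * ∑ l ∈ Finset.range (k + 1), h lam0 lam1 (I l ω) * price u d S l ω +
        b * ∑ l ∈ Finset.range (k + 1), h lam0 lam1 (J l ω) * price u d S l ω := by
      rw [Finset.mul_sum, Finset.mul_sum, ← Finset.sum_add_distrib]
      refine Finset.sum_le_sum fun l _ => ?_
      have := mul_le_mul_of_nonneg_right (h_convex hlam0 hlam1 ha hb (I l ω) (J l ω))
        (price_pos hd hu hS l ω).le
      linarith
    unfold cash
    linarith
  have hs : shares (a * x1 + b * y1) (fun k ω => a * I k ω + b * J k ω) k ω =
      a * shares x1 I k ω + b * shares y1 J k ω := by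
    simp only [shares, Finset.sum_add_distrib, ← Finset.mul_sum]
    ring
  rw [liquidation_eq, liquidation_eq, liquidation_eq, hs]
  exact (liquidationValue_concave hlam0 hlam1 (price_pos hd hu hS k ω).le ha hb _ _ _ _).trans
    (liquidationValue_mono hc _)

theorem powerUtility_mono {γ x y : ℝ} (hγ : 0 < γ) (hx : 0 ≤ x) (hxy : x ≤ y) :
    powerUtility γ x ≤ powerUtility γ y := by
  unfold powerUtility; gcongr

theorem powerUtility_concave {γ a b x y : ℝ} (hγ : 0 < γ) (hγ1 : γ < 1) (hx : 0 ≤ x) (hy : 0 ≤ y)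
    (ha : 0 ≤ a) (hb : 0 ≤ b) (hab : a + b = 1) :
    a * powerUtility γ x + b * powerUtility γ y ≤ powerUtility γ (a * x + b * y) := by
  have := (Real.concaveOn_rpow hγ.le hγ1.le).2 hx hy ha hb hab
  simp only [smul_eq_mul] at this
  unfold powerUtility
  rw [← mul_div_assoc, ← mul_div_assoc, ← add_div]
  gcongr

/-! ### The value function and strong duality -/

section Value

variable {u d p S lam0 lam1 γ : ℝ}

theorem isGreatest_value (hd : 0 < d) (hd1 : d < 1) (hu : 1 < u) (hlam0 : 0 < lam0)
    (hlam1 : 0 < lam1) (hγ : 0 < γ) (hS : 0 < S) (n : ℕ) {x0 x1 : ℝ}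
    (hx : 0 ≤ liquidationValue lam0 lam1 S x0 x1) :
    IsGreatest (expectedUtilities n u d p S lam0 lam1 (powerUtility γ) x0 x1)
      (value n u d p S lam0 lam1 (powerUtility γ) x0 x1) := by
  obtain ⟨v, hv⟩ := exists_isGreatest_expectedUtilities (p := p) hd hd1 hu hlam0 hlam1 hγ hS n hx
  rw [value, hv.csSup_eq]
  exact hv

/-- Mixing optimal strategies for two positions is admissible for the mixed position, because convex
costs only leave more cash; concavity of the utility does the rest. -/
theorem concaveOn_value (hd : 0 < d) (hd1 : d < 1) (hu : 1 < u) (hp : 0 < p) (hp1 : p < 1)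
    (hlam0 : 0 < lam0) (hlam1 : 0 < lam1) (hγ : 0 < γ) (hγ1 : γ < 1) (hS : 0 < S) (n : ℕ) :
    ConcaveOn ℝ (solvencyRegion lam0 lam1 S)
      fun x => value n u d p S lam0 lam1 (powerUtility γ) x.1 x.2 := by
  have hconv := convex_solvencyRegion hlam0 hlam1 hS.le
  refine ⟨hconv, fun x hx y hy a b ha hb hab => ?_⟩
  have hxy : 0 < liquidationValue lam0 lam1 S (a * x.1 + b * y.1) (a * x.2 + b * y.2) :=
    hconv hx hy ha hb hab
  obtain ⟨I, hI, eI⟩ :=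
    (isGreatest_value (p := p) hd hd1 hu hlam0 hlam1 hγ hS n (le_of_lt hx)).1
  obtain ⟨J, hJ, eJ⟩ :=
    (isGreatest_value (p := p) hd hd1 hu hlam0 hlam1 hγ hS n (le_of_lt hy)).1
  have hL := liquidation_concave (n := n) hd hu hS hlam0 hlam1 ha hb x.1 x.2 y.1 y.2 I J
  simp only [smul_eq_mul, Prod.fst_add, Prod.snd_add, Prod.smul_fst, Prod.smul_snd]
  rw [eI, eJ]
  refine le_trans ?_ ((isGreatest_value (p := p) hd hd1 hu hlam0 hlam1 hγ hS n hxy.le).2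
    ⟨fun k ω => a * I k ω + b * J k ω, ⟨fun k hk ω ω' hω => ?_, fun k hk ω => ?_⟩, rfl⟩)
  · rw [← expect_add_smul]
    refine expect_mono hp hp1 fun ω => ?_
    have h1 := hI.2 n le_rfl ω
    have h2 := hJ.2 n le_rfl ω
    exact (powerUtility_concave hγ hγ1 h1 h2 ha hb hab).trans
      (powerUtility_mono hγ (by positivity) (hL n ω))
  · simp only [hI.1 k hk ω ω' hω, hJ.1 k hk ω ω' hω]
  · have h1 := hI.2 k hk ω
    have h2 := hJ.2 k hk ω
    exact le_trans (by positivity) (hL k ω)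

theorem powerUtility_le_value (hd : 0 < d) (hd1 : d < 1) (hu : 1 < u) (hlam0 : 0 < lam0)
    (hlam1 : 0 < lam1) (hγ : 0 < γ) (hS : 0 < S) (n : ℕ) {x0 x1 : ℝ}
    (hx : 0 ≤ liquidationValue lam0 lam1 S x0 x1) :
    powerUtility γ (liquidationValue lam0 lam1 S x0 x1) ≤
      value n u d p S lam0 lam1 (powerUtility γ) x0 x1 := by
  obtain ⟨I, hI, hL⟩ := exists_admissible_const (n := n) (u := u) (d := d) hx
  refine (isGreatest_value hd hd1 hu hlam0 hlam1 hγ hS n hx).2 ⟨I, hI, ?_⟩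
  simp only [hL, expect_const]

/-- Waiting for the first move is one of the available choices. -/
theorem value_succ_ge (hd : 0 < d) (hd1 : d < 1) (hu : 1 < u) (hlam0 : 0 < lam0)
    (hlam1 : 0 < lam1) (hlam1' : lam1 < 1) (hγ : 0 < γ) (hS : 0 < S) (n : ℕ) {x : ℝ × ℝ}
    (hxu : x ∈ solvencyRegion lam0 lam1 (S * u)) (hxd : x ∈ solvencyRegion lam0 lam1 (S * d)) :
    p * value n u d p (S * u) lam0 lam1 (powerUtility γ) x.1 x.2 +
        (1 - p) * value n u d p (S * d) lam0 lam1 (powerUtility γ) x.1 x.2 ≤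
      value (n + 1) u d p S lam0 lam1 (powerUtility γ) x.1 x.2 := by
  have hx : 0 < liquidationValue lam0 lam1 S x.1 x.2 :=
    solvencyRegion_inter_subset hd1 hu hd hS hlam0 hlam1 hlam1' ⟨hxu, hxd⟩
  have hG : ∀ b : Bool, ∃ J : ℕ → Path n → ℝ,
      IsAdmissible u d (S * factor u d b) lam0 lam1 x.1 x.2 J ∧
      value n u d p (S * factor u d b) lam0 lam1 (powerUtility γ) x.1 x.2 =
        expect p fun ω => powerUtility γ
          (liquidation u d (S * factor u d b) lam0 lam1 x.1 x.2 J n ω) := by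
    intro b
    refine (isGreatest_value (p := p) hd hd1 hu hlam0 hlam1 hγ
      (mul_pos hS (factor_pos hd hu b)) n (x0 := x.1) (x1 := x.2) ?_).1
    cases b
    · exact le_of_lt hxd
    · exact le_of_lt hxu
  choose J hJ eJ using hG
  refine (isGreatest_value hd hd1 hu hlam0 hlam1 hγ hS (n + 1) hx.le).2
    ⟨waitStrategy J, isAdmissible_waitStrategy hJ hx.le, ?_⟩
  rw [expect_succ]
  simp only [liquidation_succ_cons u d S lam0 lam1 x.1 x.2 (I := waitStrategy J) (z := 0)
    (fun _ => rfl), tailStrategy_waitStrategy, h_zero, zero_mul, sub_zero, add_zero]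
  rw [← eJ true, ← eJ false]
  rfl

/-- The coefficients of an affine majorant of the value function are a dual variable. -/
theorem dual_mem_of_value_le (hd : 0 < d) (hd1 : d < 1) (hu : 1 < u) (hlam0 : 0 < lam0)
    (hlam1 : 0 < lam1) (hγ : 0 < γ) (hS : 0 < S) (n : ℕ) {y0 y1 C : ℝ}
    (hy : ∀ x ∈ solvencyRegion lam0 lam1 S,
      value n u d p S lam0 lam1 (powerUtility γ) x.1 x.2 ≤ y0 * x.1 + y1 * x.2 + C) :
    0 < y0 ∧ y1 / (y0 * S) ∈ Icc (1 - lam1) (1 + lam0) := by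
  have hU : ∀ x ∈ solvencyRegion lam0 lam1 S,
      powerUtility γ (liquidationValue lam0 lam1 S x.1 x.2) ≤ y0 * x.1 + y1 * x.2 + C :=
    fun x hx => (powerUtility_le_value hd hd1 hu hlam0 hlam1 hγ hS n (le_of_lt hx)).trans (hy x hx)
  have hbond : ∀ c : ℝ, liquidationValue lam0 lam1 S c 0 = c := by
    intro c; simp [liquidationValue, h_zero]
  -- Otherwise a cash position of utility `|C| + 1` exceeds the majorant.
  have hy0 : 0 < y0 := by
    by_contra! hneg
    have hpos : 0 < γ * (|C| + 1) := by positivity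
    have := hU ((γ * (|C| + 1)) ^ γ⁻¹, 0) (by
      rw [solvencyRegion, mem_ofPred_eq, hbond]; positivity)
    rw [hbond, powerUtility, ← Real.rpow_mul hpos.le, inv_mul_cancel₀ hγ.ne', Real.rpow_one,
      mul_div_cancel_left₀ _ hγ.ne'] at this
    have h2 : y0 * (γ * (|C| + 1)) ^ γ⁻¹ ≤ 0 :=
      mul_nonpos_of_nonpos_of_nonneg hneg (by positivity)
    have := le_abs_self C
    simp only at *
    linarith
  -- The region is a cone and utility is nonnegative on it, so the linear part cannot be negative:
  -- scaling by `t` would push the majorant below `0`.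
  have hcone : ∀ x ∈ solvencyRegion lam0 lam1 S, 0 ≤ y0 * x.1 + y1 * x.2 := by
    intro x hx
    by_contra! hneg
    set t := (|C| + 1) / -(y0 * x.1 + y1 * x.2) with ht
    have htpos : 0 < t := div_pos (by positivity) (by linarith)
    have hpos : 0 < liquidationValue lam0 lam1 S (t * x.1) (t * x.2) := by
      have h1 := liquidationValue_concave hlam0 hlam1 hS.le htpos.le le_rfl x.1 x.2 0 0
      have h2 : 0 < t * liquidationValue lam0 lam1 S x.1 x.2 := mul_pos htpos hx
      simp only [zero_mul, add_zero] at h1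
      linarith
    have h3 := hU (t * x.1, t * x.2) hpos
    have h4 : 0 ≤ powerUtility γ (liquidationValue lam0 lam1 S (t * x.1) (t * x.2)) :=
      div_nonneg (Real.rpow_nonneg hpos.le _) hγ.le
    have h5 : t * (y0 * x.1 + y1 * x.2) = -(|C| + 1) := by
      rw [ht, div_neg, neg_mul, div_mul_cancel₀ _ hneg.ne]
    have := le_abs_self C
    simp only at h3
    nlinarith
  have hmem : ∀ δ s : ℝ, 0 < δ →
      (δ + h lam0 lam1 (-s) * S, s) ∈ solvencyRegion lam0 lam1 S := by
    intro δ s hδ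
    simpa [solvencyRegion, liquidationValue] using hδ
  have hsupp : ∀ s : ℝ, 0 ≤ y0 * (h lam0 lam1 (-s) * S) + y1 * s := by
    intro s
    refine le_of_forall_pos_le_add fun ε hε => ?_
    have := hcone _ (hmem (ε / y0) s (div_pos hε hy0))
    have e : y0 * (ε / y0) = ε := by field_simp
    simp only at this
    linarith
  refine ⟨hy0, ?_, ?_⟩
  -- Positions of liquidation value near `0` that are long or short one share give the lower and the
  -- upper bound, respectively.
  · rw [le_div_iff₀ (by positivity)]
    have := hsupp 1
    rw [h, if_neg (by norm_num)] at this
    linarith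
  · rw [div_le_iff₀ (by positivity)]
    have := hsupp (-1)
    rw [h, if_pos (by norm_num)] at this
    linarith

/-- Strong duality: an affine majorant of the value function bounds the dual value function. -/
theorem dual_le_of_value_le (hd : 0 < d) (hd1 : d < 1) (hu : 1 < u) (hp : 0 < p) (hp1 : p < 1)
    (hlam0 : 0 < lam0) (hlam1 : 0 < lam1) (hlam1' : lam1 < 1) (hγ : 0 < γ) (hγ1 : γ < 1) (n : ℕ) :
    ∀ S y0 y1 C : ℝ, 0 < S →
      (∀ x ∈ solvencyRegion lam0 lam1 S,
        value n u d p S lam0 lam1 (powerUtility γ) x.1 x.2 ≤ y0 * x.1 + y1 * x.2 + C) →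
      (1 / γ - 1) * (y0 ^ (γ / (γ - 1)) *
        scaledToGo u d p lam0 lam1 (γ / (γ - 1)) n (y1 / (y0 * S))) ≤ C := by
  have hμ := (exponent_neg hγ hγ1).le
  have hbond : ∀ c S : ℝ, liquidationValue lam0 lam1 S c 0 = c := by
    intro c S; simp [liquidationValue, h_zero]
  induction n with
  | zero =>
    intro S y0 y1 C hS hy
    obtain ⟨hy0, -⟩ := dual_mem_of_value_le hd hd1 hu hlam0 hlam1 hγ hS 0 hy
    -- This cash amount solves `U'(x) = y0`, so it maximizes `U(x) - y0 * x`.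
    have hc : 0 < y0 ^ (1 / (γ - 1)) := Real.rpow_pos_of_pos hy0 _
    have hmem : (y0 ^ (1 / (γ - 1)), (0 : ℝ)) ∈ solvencyRegion lam0 lam1 S := by
      rw [solvencyRegion, mem_ofPred_eq, hbond]; exact hc
    have h1 := (powerUtility_le_value hd hd1 hu hlam0 hlam1 hγ hS 0 (le_of_lt hmem)).trans
      (hy _ hmem)
    have hγ' : γ - 1 ≠ 0 := by linarith
    have e1 : y0 * y0 ^ (1 / (γ - 1)) = y0 ^ (γ / (γ - 1)) := by
      rw [← Real.rpow_one_add' hy0.le]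
      · congr 1; field_simp; ring
      · have : 1 + 1 / (γ - 1) = γ / (γ - 1) := by field_simp; ring
        rw [this]; exact (exponent_neg hγ hγ1).ne
    simp only [hbond, powerUtility, mul_zero, add_zero] at h1
    rw [← Real.rpow_mul hy0.le, one_div_mul_eq_div, e1] at h1
    simp only [scaledToGo, mul_one]
    have : (1 / γ - 1) * y0 ^ (γ / (γ - 1)) =
      y0 ^ (γ / (γ - 1)) / γ - y0 ^ (γ / (γ - 1)) := by ring
    linarith
  | succ n ih =>
    intro S y0 y1 C hS hy
    have hq : 0 < 1 - p := by linarith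
    have hu0 : 0 < u := by linarith
    obtain ⟨hy0, hR⟩ := dual_mem_of_value_le hd hd1 hu hlam0 hlam1 hγ hS (n + 1) hy
    have hSu : 0 < S * u := by positivity
    have hSd : 0 < S * d := by positivity
    have haff : ConcaveOn ℝ (solvencyRegion lam0 lam1 (S * u))
        fun x : ℝ × ℝ => -(y0 * x.1 + y1 * x.2 + C) := by
      refine ⟨convex_solvencyRegion hlam0 hlam1 hSu.le, fun x _ z _ a b _ _ hab => le_of_eq ?_⟩
      simp only [smul_eq_mul, Prod.fst_add, Prod.snd_add, Prod.smul_fst, Prod.smul_snd]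
      linear_combination -C * hab
    have hfu := ((concaveOn_value (p := p) hd hd1 hu hp hp1 hlam0 hlam1 hγ hγ1 hSu n).smul
      hp.le).add haff
    have hfd := (concaveOn_value (p := p) hd hd1 hu hp hp1 hlam0 hlam1 hγ hγ1 hSd n).smul hq.le
    -- With `ℓ` the given majorant, the sandwich yields an affine `m` with `p V_u ≤ ℓ + m` and `(1 -
    -- p) V_d ≤ -m`, each on its own solvency region and not just on the intersection.
    obtain ⟨m0, m1, C', h1, h2⟩ := exists_affine_between
      (isOpen_solvencyRegion hlam0 hlam1 (S * u)) hfu hfd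
      ⟨(1, 0), by simp [solvencyRegion, hbond], by simp [solvencyRegion, hbond]⟩ (by
        rintro x ⟨hxu, hxd⟩
        have e1 := value_succ_ge (p := p) hd hd1 hu hlam0 hlam1 hlam1' hγ hS n hxu hxd
        have e2 := hy x (solvencyRegion_inter_subset hd1 hu hd hS hlam0 hlam1 hlam1' ⟨hxu, hxd⟩)
        simp only [Pi.add_apply, smul_eq_mul]
        linarith)
    simp only [Pi.add_apply, smul_eq_mul] at h1 h2
    have hyu : ∀ x ∈ solvencyRegion lam0 lam1 (S * u),
        value n u d p (S * u) lam0 lam1 (powerUtility γ) x.1 x.2 ≤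
          (y0 + m0) / p * x.1 + (y1 + m1) / p * x.2 + (C + C') / p := by
      intro x hx
      have e : (y0 + m0) / p * x.1 + (y1 + m1) / p * x.2 + (C + C') / p =
        ((y0 + m0) * x.1 + (y1 + m1) * x.2 + (C + C')) / p := by ring
      rw [e, le_div_iff₀ hp]
      linarith [h1 x hx]
    have hyd : ∀ x ∈ solvencyRegion lam0 lam1 (S * d),
        value n u d p (S * d) lam0 lam1 (powerUtility γ) x.1 x.2 ≤
          -m0 / (1 - p) * x.1 + -m1 / (1 - p) * x.2 + -C' / (1 - p) := by
      intro x hx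
      have e : -m0 / (1 - p) * x.1 + -m1 / (1 - p) * x.2 + -C' / (1 - p) =
        (-m0 * x.1 + -m1 * x.2 + -C') / (1 - p) := by ring
      rw [e, le_div_iff₀ hq]
      linarith [h2 x hx]
    obtain ⟨hu0', hRu⟩ := dual_mem_of_value_le hd hd1 hu hlam0 hlam1 hγ hSu n hyu
    obtain ⟨hd0', hRd⟩ := dual_mem_of_value_le hd hd1 hu hlam0 hlam1 hγ hSd n hyd
    have bu := mul_le_mul_of_nonneg_left (ih _ _ _ _ hSu hyu) hp.le
    have bd := mul_le_mul_of_nonneg_left (ih _ _ _ _ hSd hyd) hq.le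
    rw [mul_div_cancel₀ _ hp.ne'] at bu
    rw [mul_div_cancel₀ _ hq.ne'] at bd
    set Ru := (y1 + m1) / p / ((y0 + m0) / p * (S * u)) with hRu'
    set Rd := -m1 / (1 - p) / (-m0 / (1 - p) * (S * d)) with hRd'
    have hmu : 0 < y0 + m0 := by
      have := mul_pos hu0' hp; rwa [div_mul_cancel₀ _ hp.ne'] at this
    have hmd : 0 < -m0 := by
      have := mul_pos hd0' hq; rwa [div_mul_cancel₀ _ hq.ne'] at this
    have hα : 0 < (y0 + m0) / y0 := div_pos hmu hy0
    have hα1 : (y0 + m0) / y0 < 1 := by rw [div_lt_one hy0]; linarith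
    have e1 : 1 - (y0 + m0) / y0 = -m0 / y0 := by field_simp; ring
    -- `α` is the fraction of the cash slope `y0` carried by the up branch. The constraint holds
    -- because the share slopes `y1 + m1` and `-m1` add up to `y1`.
    have hle := scaledToGo_succ_le (lam0 := lam0) (lam1 := lam1) hp hp1 hd1 hu hμ n
      (A := y1 / (y0 * S)) ⟨(y0 + m0) / y0, Ru, Rd, hα, hα1, hRu, hRd, by
        have hm0 : m0 ≠ 0 := by linarith
        rw [e1, hRu', hRd']
        field_simp
        ring, rfl⟩
    have wu := mul_div_rpow (μ := γ / (γ - 1)) hp hα hy0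
    have wd := mul_div_rpow (μ := γ / (γ - 1)) hq (sub_pos.2 hα1) hy0
    rw [mul_div_cancel₀ _ hy0.ne'] at wu
    rw [e1, mul_div_cancel₀ _ hy0.ne', ← e1] at wd
    have hc : 0 < 1 / γ - 1 := by rw [sub_pos, lt_div_iff₀ hγ]; linarith
    have hyμ : 0 < y0 ^ (γ / (γ - 1)) := Real.rpow_pos_of_pos hy0 _
    have h3 := mul_le_mul_of_nonneg_left hle (mul_pos hc hyμ).le
    set gu := scaledToGo u d p lam0 lam1 (γ / (γ - 1)) n Ru
    set gd := scaledToGo u d p lam0 lam1 (γ / (γ - 1)) n Rd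
    rw [← mul_assoc]
    refine h3.trans ?_
    calc _ = (1 / γ - 1) * (y0 ^ (γ / (γ - 1)) *
            (p ^ (1 - γ / (γ - 1)) * ((y0 + m0) / y0) ^ (γ / (γ - 1))) * gu +
          y0 ^ (γ / (γ - 1)) * ((1 - p) ^ (1 - γ / (γ - 1)) *
            (1 - (y0 + m0) / y0) ^ (γ / (γ - 1))) * gd) := by ring
      _ = (1 / γ - 1) * (p * ((y0 + m0) / p) ^ (γ / (γ - 1)) * gu +
          (1 - p) * (-m0 / (1 - p)) ^ (γ / (γ - 1)) * gd) := by rw [wu, wd]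
      _ ≤ C := by linarith

end Value

end BinomialMarket

/-! ### The duality formula and the one-sided cases -/

open BinomialMarket in
theorem value_eq_sInf_dualObjective {T : ℕ} {u d p S lam0 lam1 γ x0 x1 : ℝ}
    (hd : 0 < d) (hd1 : d < 1) (hu : 1 < u) (hp : 0 < p) (hp1 : p < 1) (hS : 0 < S)
    (hlam0 : 0 < lam0) (hlam1 : 0 < lam1) (hlam1' : lam1 < 1)
    (hγ : 0 < γ) (hγ1 : γ < 1) (hx : 0 < liquidationValue lam0 lam1 S x0 x1) :
    value T u d p S lam0 lam1 (powerUtility γ) x0 x1 =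
      1 / γ * sInf (dualObjective T u d p S lam0 lam1 γ x0 x1 ''
        Set.Icc (1 - lam1) (1 + lam0)) := by
  have hμ := (exponent_neg hγ hγ1).le
  have hV : ∀ R ∈ Set.Icc (1 - lam1) (1 + lam0),
      1 ≤ scaledToGo u d p lam0 lam1 (γ / (γ - 1)) T R := one_le_scaledToGo hd1 hu hp hp1 hμ T
  have hM : ∀ R ∈ Set.Icc (1 - lam1) (1 + lam0), 0 < x0 + x1 * S * R := fun R hR =>
    hx.trans_le (liquidationValue_le hlam0 hlam1 hS.le hR x0 x1)
  have hobj : ∀ R, dualObjective T u d p S lam0 lam1 γ x0 x1 R = (x0 + x1 * S * R) ^ γ *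
      scaledToGo u d p lam0 lam1 (γ / (γ - 1)) T R ^ (1 - γ) := fun _ => rfl
  obtain ⟨I, hI, eI⟩ :=
    (isGreatest_value (p := p) hd hd1 hu hlam0 hlam1 hγ hS T hx.le).1
  have hweak : ∀ R ∈ Set.Icc (1 - lam1) (1 + lam0),
      value T u d p S lam0 lam1 (powerUtility γ) x0 x1 ≤
        1 / γ * dualObjective T u d p S lam0 lam1 γ x0 x1 R := by
    intro R hR
    obtain ⟨y, hy, e⟩ := exists_conjugate_eq hγ1 (hM R hR) (zero_lt_one.trans_le (hV R hR))
    rw [hobj, ← e, eI]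
    exact expect_powerUtility_le hd hd1 hu hp hp1 hlam0 hlam1 hγ hγ1 T S x0 x1 I y R hS hI hy hR
  rw [one_div, ← div_eq_inv_mul]
  apply le_antisymm
  · rw [le_div_iff₀ hγ]
    refine le_csInf (Set.Nonempty.image _ ⟨1, by linarith, by linarith⟩) ?_
    rintro _ ⟨R, hR, rfl⟩
    have := hweak R hR
    rwa [one_div, ← div_eq_inv_mul, le_div_iff₀ hγ] at this
  -- The sandwich with a singleton `B` gives an affine majorant touching the value function at `(x0,
  -- x1)`; the ratio formed from its slopes is a minimizer.
  · obtain ⟨m0, m1, C, h1, h2⟩ := exists_affine_between (B := {(x0, x1)})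
      (g := fun _ => -value T u d p S lam0 lam1 (powerUtility γ) x0 x1)
      (isOpen_solvencyRegion hlam0 hlam1 S)
      (concaveOn_value (p := p) hd hd1 hu hp hp1 hlam0 hlam1 hγ hγ1 hS T)
      (concaveOn_const _ (convex_singleton _)) ⟨(x0, x1), hx, rfl⟩ (by
        rintro _ ⟨-, rfl⟩; simp)
    have h3 := h2 (x0, x1) rfl
    obtain ⟨hm0, hR⟩ := dual_mem_of_value_le hd hd1 hu hlam0 hlam1 hγ hS T h1
    have h4 := dual_le_of_value_le hd hd1 hu hp hp1 hlam0 hlam1 hlam1' hγ hγ1 T S m0 m1 C hS h1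
    have h5 := powerUtility_le_conjugate hγ hγ1 (hM _ hR).le hm0 (zero_le_one.trans (hV _ hR))
    have e : m0 * (x0 + x1 * S * (m1 / (m0 * S))) = m0 * x0 + m1 * x1 := by
      field_simp
    rw [e, ← hobj, one_div, ← div_eq_inv_mul] at h5
    have h6 : sInf (dualObjective T u d p S lam0 lam1 γ x0 x1 ''
        Set.Icc (1 - lam1) (1 + lam0)) ≤
        dualObjective T u d p S lam0 lam1 γ x0 x1 (m1 / (m0 * S)) := by
      refine csInf_le ⟨0, ?_⟩ (Set.mem_image_of_mem _ hR)
      rintro _ ⟨R, hR, rfl⟩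
      have h7 := hM R hR
      have h8 := zero_le_one.trans (hV R hR)
      rw [hobj]
      positivity
    refine (div_le_div_of_nonneg_right h6 hγ.le).trans ?_
    rw [one_div] at h4
    simp only at h3
    linarith

theorem sInf_image_eq_of_isMinOn {f : ℝ → ℝ} {s : Set ℝ} {a : ℝ} (ha : a ∈ s)
    (hmin : IsMinOn f s a) : sInf (f '' s) = f a :=
  IsLeast.csInf_eq ⟨Set.mem_image_of_mem f ha, by rintro _ ⟨b, hb, rfl⟩; exact hmin hb⟩

theorem theorem5 (T : ℕ) (u d p S lam0 lam1 γ x0 x1 : ℝ)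
    (hd : 0 < d) (hd1 : d < 1) (hu : 1 < u) (hp : 0 < p) (hp1 : p < 1) (hS : 0 < S)
    (hlam0 : 0 < lam0) (hlam1 : 0 < lam1) (hlam1' : lam1 < 1)
    (hγ : 0 < γ) (hγ1 : γ < 1)
    (hx : 0 < x0 - BinomialMarket.h lam0 lam1 (-x1) * S) :
    IsGreatest
      (BinomialMarket.expectedUtilities T u d p S lam0 lam1
        (BinomialMarket.powerUtility γ) x0 x1)
      (BinomialMarket.value T u d p S lam0 lam1 (BinomialMarket.powerUtility γ) x0 x1) ∧
    BinomialMarket.value T u d p S lam0 lam1 (BinomialMarket.powerUtility γ) x0 x1 =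
      1 / γ * sInf (BinomialMarket.dualObjective T u d p S lam0 lam1 γ x0 x1 ''
        Set.Icc (1 - lam1) (1 + lam0)) ∧
    (1 < p * u + (1 - p) * d → x1 ≤ 0 →
      IsMinOn (BinomialMarket.dualObjective T u d p S lam0 lam1 γ x0 x1)
        (Set.Icc (1 - lam1) (1 + lam0)) (1 + lam0) ∧
      BinomialMarket.value T u d p S lam0 lam1 (BinomialMarket.powerUtility γ) x0 x1 =
        1 / γ * ((x0 + x1 * S * (1 + lam0)) ^ γ *
          BinomialMarket.Vhat T u d p lam0 lam1 γ 0 (1 + lam0) ^ (1 - γ))) ∧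
    (p * u + (1 - p) * d < 1 → 0 ≤ x1 →
      IsMinOn (BinomialMarket.dualObjective T u d p S lam0 lam1 γ x0 x1)
        (Set.Icc (1 - lam1) (1 + lam0)) (1 - lam1) ∧
      BinomialMarket.value T u d p S lam0 lam1 (BinomialMarket.powerUtility γ) x0 x1 =
        1 / γ * ((x0 + x1 * S * (1 - lam1)) ^ γ *
          BinomialMarket.Vhat T u d p lam0 lam1 γ 0 (1 - lam1) ^ (1 - γ))) := by
  have hx' : 0 < BinomialMarket.liquidationValue lam0 lam1 S x0 x1 := hx
  have hμ := (BinomialMarket.exponent_neg hγ hγ1).le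
  have hval := value_eq_sInf_dualObjective (T := T) hd hd1 hu hp hp1 hS hlam0 hlam1 hlam1' hγ hγ1 hx'
  have hV : ∀ R ∈ Set.Icc (1 - lam1) (1 + lam0),
      0 ≤ BinomialMarket.Vhat T u d p lam0 lam1 γ 0 R := fun R hR =>
    zero_le_one.trans (BinomialMarket.one_le_scaledToGo hd1 hu hp hp1 hμ T R hR)
  have hM : ∀ R ∈ Set.Icc (1 - lam1) (1 + lam0), 0 ≤ x0 + x1 * S * R := fun R hR =>
    (hx'.trans_le (BinomialMarket.liquidationValue_le hlam0 hlam1 hS.le hR x0 x1)).le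
  -- The objective is a product of powers of nonnegative quantities, so a common minimizer of both
  -- minimizes it.
  have hmin : ∀ R ∈ Set.Icc (1 - lam1) (1 + lam0),
      (∀ R' ∈ Set.Icc (1 - lam1) (1 + lam0), x1 * S * R ≤ x1 * S * R' ∧
        BinomialMarket.Vhat T u d p lam0 lam1 γ 0 R ≤
          BinomialMarket.Vhat T u d p lam0 lam1 γ 0 R') →
      IsMinOn (BinomialMarket.dualObjective T u d p S lam0 lam1 γ x0 x1)
        (Set.Icc (1 - lam1) (1 + lam0)) R ∧
      BinomialMarket.value T u d p S lam0 lam1 (BinomialMarket.powerUtility γ) x0 x1 =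
        1 / γ * ((x0 + x1 * S * R) ^ γ *
          BinomialMarket.Vhat T u d p lam0 lam1 γ 0 R ^ (1 - γ)) := by
    intro R hR hle
    have hmin : IsMinOn (BinomialMarket.dualObjective T u d p S lam0 lam1 γ x0 x1)
        (Set.Icc (1 - lam1) (1 + lam0)) R := by
      intro R' hR'
      have h1 := hM R hR
      have h2 := hV R hR
      have h3 := hM R' hR'
      exact mul_le_mul
        (Real.rpow_le_rpow h1 (add_le_add_right (hle R' hR').1 x0) hγ.le)
        (Real.rpow_le_rpow h2 (hle R' hR').2 (by linarith))
        (Real.rpow_nonneg h2 _) (Real.rpow_nonneg h3 _)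
    refine ⟨hmin, ?_⟩
    rw [hval, sInf_image_eq_of_isMinOn hR hmin]
    rfl
  refine ⟨BinomialMarket.isGreatest_value hd hd1 hu hlam0 hlam1 hγ hS T hx'.le, hval,
    fun hdrift hx1 => ?_, fun hdrift hx1 => ?_⟩
  · have htop : 1 + lam0 ∈ Set.Icc (1 - lam1) (1 + lam0) := ⟨by linarith, le_rfl⟩
    refine hmin _ htop fun R hR => ⟨?_, ?_⟩
    · exact mul_le_mul_of_nonpos_left hR.2 (mul_nonpos_of_nonpos_of_nonneg hx1 hS.le)
    · exact BinomialMarket.scaledToGo_antitoneOn hd hd1 hu hp hp1 hlam0 hlam1 hμ hdrift T hR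
        htop hR.2
  · have hbot : 1 - lam1 ∈ Set.Icc (1 - lam1) (1 + lam0) := ⟨le_rfl, by linarith⟩
    refine hmin _ hbot fun R hR => ⟨?_, ?_⟩
    · exact mul_le_mul_of_nonneg_left hR.1 (mul_nonneg hx1 hS.le)
    · exact BinomialMarket.scaledToGo_monotoneOn hd1 hu hp hp1 hlam0 hlam1 hlam1' hμ hdrift T
        hbot hR hR.1
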